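/- Let $k\ge 0$, let $\rho$ be the right regular representation $(\rho_m\xi)(n)=\xi(n+m)$ of $\mathbb Z^k$ on $\ell^2(\mathbb Z^k)$, let $\mathcal K=\mathcal K(\ell^2(\mathbb Z^k))$ carry the action $\mathrm{Ad}\,\rho$, and let $\xi\mapsto\widehat\xi(z)=\sum_n\xi(n)z^n$ be the Fourier transform $\ell^2(\mathbb Z^k)\cong L^2(\mathbb T^k)$. Definitions. A subset $\mathcal R$ of $\ell^2(\mathbb Z^k)$ (resp. of $\mathcal K$) is relatively $L^1$ if $t\mapsto\langle\xi,\rho_t\eta\rangle$ (resp. $t\mapsto\xi^*\,\mathrm{Ad}\rho_t(\eta)$) is absolutely summable over $\mathbb Z^k$ for all $\xi,\eta\in\mathcal R$; $\mathrm{Ad}\,\rho$ is Rieffel proper with respect to a subspace $\mathcal R$ of $\mathcal K$ if $\mathcal R$ is dense and relatively $L^1$. It is Rieffel proper if there is a dense $\mathrm{Ad}\,\rho$-invariant $*$-subalgebra $A_0\subseteq\mathcal K$ that is relatively $L^1$ and such that for all $a,b\in A_0$ there is an $\mathrm{Ad}\,\rho$-invariant multiplier $m\in\mathcal M(\mathcal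 K)$ with $mc=\sum_t\mathrm{Ad}\rho_t(ab^*)c$ (absolutely convergent) for all $c\in A_0$, and $mA_0\subseteq A_0$, $A_0m\subseteq A_0$. The generalised fixed-point algebra of $\mathrm{Ad}\,\rho$ with respect to $\mathcal R\subseteq\mathcal K$ is the C*-subalgebra of $\mathcal M(\mathcal K)$ generated by the existing strict unconditional sums $\sum_t\mathrm{Ad}\rho_t(ab^*)$, $a,b\in\mathcal R$. A vector $\xi\in\ell^2(\mathbb Z^k)$ is square-integrable if there is a bounded operator $|\xi\rangle\rangle$ on $\ell^2(\mathbb Z^k)$ with $|\xi\rangle\rangle\delta_t=\rho_{-t}\xi$ for all $t$. For $\mathcal R\subseteq\ell^2(\mathbb Z^k)$, $\mathrm{Fix}(\ell^2(\mathbb Z^k),\mathcal R)$ is the C*-algebra of operators generated by the $|\xi\rangle\rangle|\eta\rangle\rangle^*$ for square-integrable $\xi,\eta\in\mathcal R$, and $\mathcal F(\mathcal R)$ is the norm closure of the linear span of the operators $|\xi\rangle\rangle$ with $\xi$ in the linear span of $\{\rho_t\zeta:t\in\mathbb Z^k,\zeta\in\mathcal R\}$, with right inner product $V^*W$, left inner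 product $VW^*$ and composition as module actions; here $C^*(\mathbb Z^k)\subseteq\mathcal L(\ell^2(\mathbb Z^k))$ is identified with $C(\mathbb T^k)$ acting by multiplication after Fourier transform. (1) Let $S\subseteq\mathbb T^k$ be open and dense with full Haar measure, let $\mathcal R_S=\{\xi:\widehat\xi\in C_c^\infty(S)\}$ and $\mathcal R_{S,\mathcal K}=\mathrm{span}\{|\xi\rangle\langle\eta|:\xi\in\mathcal R_S,\ \eta\in\ell^2(\mathbb Z^k)\}\subseteq\mathcal K$. Then: (a) $\mathcal R_S$ is a dense relatively $L^1$ subspace of $\ell^2(\mathbb Z^k)$ and consists of square-integrable vectors. (b) $\mathrm{Ad}\,\rho$ is Rieffel proper with respect to $\mathcal R_{S,\mathcal K}$. The strict unconditional sums $\sum_t\mathrm{Ad}\rho_t(ab^*)$, $a,b\in\mathcal R_{S,\mathcal K}$, exist in $\mathcal M(\mathcal K)$ and are $\mathrm{Ad}\,\rho$-invariant. Moreover, $\mathrm{Ad}\,\rho$ is Rieffel proper via some $A_0$ as above that has the same generalised fixed-point algebra as $\mathcal R_{S,\mathcal K}$. (c) Under $\mathcal M(\mathcal K)=\mathcal L(\ell^2(\mathbb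 Z^k))$, the generalised fixed-point algebra with respect to $\mathcal R_{S,\mathcal K}$ is $\mathrm{Fix}(\ell^2(\mathbb Z^k),\mathcal R_S)$. The Hilbert bimodule $\mathcal F(\mathcal R_S)$ over $\mathrm{Fix}(\ell^2(\mathbb Z^k),\mathcal R_S)$ and $C(\mathbb T^k)$ is isomorphic, together with its left coefficient algebra, to the standard $C_0(S)$-$C_0(S)$ bimodule $C_0(S)$, where the right coefficient algebra $C_0(S)$ is an ideal of $C(\mathbb T^k)$. In particular the generalised fixed-point algebra is isomorphic to $C_0(S)$. (2) If $k\ge1$, there is a sequence $(S_n)_{n\in\mathbb N}$ of pairwise non-homeomorphic open dense subsets of $\mathbb T^k$ of full Haar measure such that the generalised fixed-point algebras of $\mathrm{Ad}\,\rho$ with respect to $\mathcal R_{S_n,\mathcal K}$ are pairwise non-isomorphic as C*-algebras. -/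

import Mathlib

open MeasureTheory
open scoped ContDiff InnerProductSpace ZeroAtInfty MultiplierAlgebra

noncomputable section

namespace RieffelProper

/-! ## Actions of discrete groups on C*-algebras

Throughout `G` is a discrete group. Haar measure is counting measure, the modular function is `1`,
so that `L¹(G, A)` (and its variant weighted by powers of the modular function) is `ℓ¹(G, A)`, the
compact subsets of `G` are the finite ones, and Bochner integrals over them are finite sums.
A `G`-algebra is a C*-algebra `A` with a homomorphism `α : G →* (A ≃⋆ₐ[ℂ] A)`. -/

section Algebra

variable {G A : Type*} [Group G] [NonUnitalCStarAlgebra A]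

/-- `m ∈ M(A)` is the strict-unconditional integral of `f : G → A`: the net of the finite partial
sums of `f` converges to `m` in the strict topology of `M(A)`. -/
def IsStrictIntegral (f : G → A) (m : 𝓜(ℂ, A)) : Prop :=
  ∀ a : A, HasSum (fun t => f t * a) (m.fst a) ∧ HasSum (fun t => a * f t) (m.snd a)

/-- `m ∈ M(A)` is fixed by (the canonical extension to `M(A)` of) the action. -/
def IsInvariant (α : G →* (A ≃⋆ₐ[ℂ] A)) (m : 𝓜(ℂ, A)) : Prop :=
  ∀ (t : G) (a : A), α t (m.fst a) = m.fst (α t a) ∧ α t (m.snd a) = m.snd (α t a)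

/-- Integrability of the functions `t ↦ ξ* α_t(η)`, for `ξ, η ∈ R`. -/
def IsRelativelyL1Alg (α : G →* (A ≃⋆ₐ[ℂ] A)) (R : Set A) : Prop :=
  ∀ ξ ∈ R, ∀ η ∈ R, Summable fun t => ‖star ξ * α t η‖

/-- The action is Rieffel proper with respect to the subspace `R`: it is dense, and
`t ↦ ξ* α_t(η)` lies in `L¹(G, A)` for all `ξ, η ∈ R`. -/
def IsRieffelProperWrt (α : G →* (A ≃⋆ₐ[ℂ] A)) (R : Submodule ℂ A) : Prop :=
  Dense (R : Set A) ∧ IsRelativelyL1Alg α R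

/-- Rieffel's original conditions on a dense `G`-invariant `*`-subalgebra `A₀`; the action is
Rieffel proper if there is such an `A₀`. -/
structure IsRieffelSubalgebra (α : G →* (A ≃⋆ₐ[ℂ] A)) (A₀ : NonUnitalStarSubalgebra ℂ A) :
    Prop where
  dense : Dense (A₀ : Set A)
  map_mem : ∀ (t : G), ∀ ξ ∈ A₀, α t ξ ∈ A₀
  relativelyL1 : IsRelativelyL1Alg α (A₀ : Set A)
  exists_inner : ∀ ξ ∈ A₀, ∀ η ∈ A₀, ∃ m : 𝓜(ℂ, A), IsInvariant α m ∧
    (∀ ζ ∈ A₀, (Summable fun t => ‖α t (ξ * star η) * ζ‖) ∧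
      HasSum (fun t => α t (ξ * star η) * ζ) (m.fst ζ)) ∧
    (∀ ζ ∈ A₀, m.fst ζ ∈ A₀) ∧ (∀ ζ ∈ A₀, m.snd ζ ∈ A₀)

/-- The generalised fixed-point algebra `A^{G,α}` with respect to `R`: the C*-subalgebra of `M(A)`
generated by the strict-unconditional integrals of `t ↦ α_t(ξη*)`, `ξ, η ∈ R`. -/
def fixedPointAlgebra (α : G →* (A ≃⋆ₐ[ℂ] A)) (R : Set A) : NonUnitalStarSubalgebra ℂ 𝓜(ℂ, A) :=
  (NonUnitalStarAlgebra.adjoin ℂ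
    {m : 𝓜(ℂ, A) | ∃ ξ ∈ R, ∃ η ∈ R,
      IsStrictIntegral (fun t => α t (ξ * star η)) m}).topologicalClosure

end Algebra

/-! ## Compact operators on a Hilbert space -/

section Compact

variable (H : Type*) [NormedAddCommGroup H] [InnerProductSpace ℂ H] [CompleteSpace H]

/-- The linear span of the rank-one operators `|ξ⟩⟨η|`. -/
def finiteRank : NonUnitalStarSubalgebra ℂ (H →L[ℂ] H) where
  toSubmodule := Submodule.span ℂ {T | ∃ ξ η : H, T = InnerProductSpace.rankOne ℂ ξ η}
  mul_mem' := by
    intro a b ha hb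
    change a * b ∈ Submodule.span ℂ _
    induction ha using Submodule.span_induction with
    | zero => simp
    | add x y _ _ hx hy => rw [add_mul]; exact add_mem hx hy
    | smul c x _ hx => rw [smul_mul_assoc]; exact Submodule.smul_mem _ c hx
    | mem x hx =>
      obtain ⟨ξ, η, rfl⟩ := hx
      refine Submodule.subset_span ⟨ξ, ContinuousLinearMap.adjoint b η, ?_⟩
      rw [ContinuousLinearMap.mul_def, InnerProductSpace.rankOne_comp]
  star_mem' := by
    intro a ha
    change star a ∈ Submodule.span ℂ _
    induction ha using Submodule.span_induction with
    | zero => simp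
    | add x y _ _ hx hy => rw [star_add]; exact add_mem hx hy
    | smul c x _ hx => rw [star_smul]; exact Submodule.smul_mem _ _ hx
    | mem x hx =>
      obtain ⟨ξ, η, rfl⟩ := hx
      refine Submodule.subset_span ⟨η, ξ, ?_⟩
      rw [ContinuousLinearMap.star_eq_adjoint, InnerProductSpace.adjoint_rankOne]

/-- The C*-algebra `K(H)` of compact operators: the norm closure of the span of the rank-one
operators. -/
def compactOps : NonUnitalStarSubalgebra ℂ (H →L[ℂ] H) :=
  (finiteRank H).topologicalClosure

instance : IsClosed (compactOps H : Set (H →L[ℂ] H)) :=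
  (finiteRank H).isClosed_topologicalClosure

variable {H}

/-- The rank-one operator `|ξ⟩⟨η|`, `ζ ↦ ⟨η, ζ⟩ ξ`, as an element of `K(H)`. -/
def ketBra (ξ η : H) : compactOps H :=
  ⟨InnerProductSpace.rankOne ℂ ξ η,
    (finiteRank H).le_topologicalClosure (Submodule.subset_span ⟨ξ, η, rfl⟩)⟩

theorem conj_mem_compactOps (v : unitary (H →L[ℂ] H)) {T : H →L[ℂ] H} (hT : T ∈ compactOps H) :
    (v : H →L[ℂ] H) * T * star (v : H →L[ℂ] H) ∈ compactOps H := by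
  refine map_mem_closure (f := fun T : H →L[ℂ] H => (v : H →L[ℂ] H) * T * star (v : H →L[ℂ] H))
    (by fun_prop) hT ?_
  intro S hS
  change S ∈ Submodule.span ℂ _ at hS
  change (v : H →L[ℂ] H) * S * star (v : H →L[ℂ] H) ∈ Submodule.span ℂ _
  induction hS using Submodule.span_induction with
  | zero => simp
  | add x y _ _ hx hy => rw [mul_add, add_mul]; exact add_mem hx hy
  | smul c x _ hx => rw [mul_smul_comm, smul_mul_assoc]; exact Submodule.smul_mem _ c hx
  | mem x hx =>
    obtain ⟨ξ, η, rfl⟩ := hx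
    refine Submodule.subset_span ⟨(v : H →L[ℂ] H) ξ, (v : H →L[ℂ] H) η, ?_⟩
    rw [ContinuousLinearMap.mul_def, ContinuousLinearMap.mul_def,
      InnerProductSpace.comp_rankOne, InnerProductSpace.rankOne_comp,
      ContinuousLinearMap.star_eq_adjoint, ContinuousLinearMap.adjoint_adjoint]

/-- Conjugation `T ↦ v T v*` by a unitary, as an automorphism of `K(H)`. -/
def conjCompact (v : unitary (H →L[ℂ] H)) : compactOps H ≃⋆ₐ[ℂ] compactOps H where
  toFun T := ⟨Unitary.conjStarAlgAut ℂ _ v T, conj_mem_compactOps v T.2⟩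
  invFun T := ⟨Unitary.conjStarAlgAut ℂ _ v⁻¹ T, conj_mem_compactOps v⁻¹ T.2⟩
  left_inv T := by ext1; simp [← StarAlgEquiv.mul_apply, -Unitary.conjStarAlgAut_apply]
  right_inv T := by ext1; simp [← StarAlgEquiv.mul_apply, -Unitary.conjStarAlgAut_apply]
  map_mul' S T := Subtype.ext (map_mul (Unitary.conjStarAlgAut ℂ _ v) _ _)
  map_add' S T := Subtype.ext (map_add (Unitary.conjStarAlgAut ℂ _ v) _ _)
  map_star' T := Subtype.ext (map_star (Unitary.conjStarAlgAut ℂ _ v) _)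
  map_smul' c T := Subtype.ext (map_smul (Unitary.conjStarAlgAut ℂ _ v) c _)

/-- The action `Ad u` on `K(H)` of a unitary representation `u` of `G` on `H`. -/
def adAction {G : Type*} [Group G] (u : G →* unitary (H →L[ℂ] H)) :
    G →* (compactOps H ≃⋆ₐ[ℂ] compactOps H) where
  toFun t := conjCompact (u t)
  map_one' := by ext T : 2; simp [conjCompact]
  map_mul' s t := by ext T : 2; simp [conjCompact, mul_assoc]

end Compact

/-! ## Unitary representations of discrete groups

A unitary representation is an equivariant Hilbert module over `ℂ` with trivial action. -/

/-- The Hilbert space `ℓ²(G)`. -/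
abbrev EllTwo (G : Type*) : Type _ := lp (fun _ : G => ℂ) 2

section Representation

variable {G H : Type*} [Group G] [NormedAddCommGroup H] [InnerProductSpace ℂ H] [CompleteSpace H]

/-- `R` is relatively `L¹`: the functions `t ↦ ⟨ξ, u_t η⟩` with `ξ, η ∈ R` lie in `ℓ¹(G)`. -/
def IsRelativelyL1 (u : G →* unitary (H →L[ℂ] H)) (R : Set H) : Prop :=
  ∀ ξ ∈ R, ∀ η ∈ R, Summable fun t => ‖⟪ξ, (u t : H →L[ℂ] H) η⟫_ℂ‖

open Classical in
/-- `V` is the bounded extension `|ξ⟩⟩ : ℓ²(G) → H` of `f ↦ ∑ₜ f(t) u_{t⁻¹} ξ`, `f ∈ C_c(G)`.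
The vector `ξ` is square integrable if there is such a `V`. -/
def IsKet (u : G →* unitary (H →L[ℂ] H)) (ξ : H) (V : EllTwo G →L[ℂ] H) : Prop :=
  ∀ t : G, V (lp.single 2 t (1 : ℂ)) = (u t⁻¹ : H →L[ℂ] H) ξ

/-- `Fix(H, R)`: the C*-subalgebra of `L(H)` generated by the operators `|ξ⟩⟩⟨⟨η|` with
`ξ, η ∈ R`, where `⟨⟨η| = |η⟩⟩*`. -/
def Fix (u : G →* unitary (H →L[ℂ] H)) (R : Set H) : NonUnitalStarSubalgebra ℂ (H →L[ℂ] H) :=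
  (NonUnitalStarAlgebra.adjoin ℂ
    {T : H →L[ℂ] H | ∃ ξ ∈ R, ∃ η ∈ R, ∃ V W : EllTwo G →L[ℂ] H,
      IsKet u ξ V ∧ IsKet u η W ∧ T = V ∘L ContinuousLinearMap.adjoint W}).topologicalClosure

/-- `R * C_c(G)`, the span of the vectors `ξ * φ = ∑ₜ φ(t⁻¹) u_t ξ` with `ξ ∈ R` and `φ`
finitely supported. -/
def convSpan (u : G →* unitary (H →L[ℂ] H)) (R : Set H) : Submodule ℂ H :=
  Submodule.span ℂ {x | ∃ t : G, ∃ ξ ∈ R, x = (u t : H →L[ℂ] H) ξ}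

/-- The Hilbert `C*_r(G)`-module `F(R)`, that is, the completion of `R * C_c(G)` for the inner
product `⟨⟨ξ|η⟩⟩ = ⟨⟨ξ| ∘ |η⟩⟩ ∈ C*_r(G) ⊆ L(ℓ²(G))`. As `‖⟨⟨ξ| ∘ |ξ⟩⟩‖ = ‖|ξ⟩⟩‖²`, the completion is
the norm closure of the space of the operators `|ξ⟩⟩`. The inner products are `⟨V, W⟩ = V* W`
(right, with values in `C*_r(G)`) and `V W*` (left, with values in `Fix(H, R)`), and both module
actions are composition of operators. -/
def ketModule (u : G →* unitary (H →L[ℂ] H)) (R : Set H) : Submodule ℂ (EllTwo G →L[ℂ] H) :=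
  (Submodule.span ℂ {V : EllTwo G →L[ℂ] H | ∃ ξ ∈ convSpan u R, IsKet u ξ V}).topologicalClosure

/-- `R_K`, the span of the operators `|ξ⟩⟨η|` with `ξ ∈ R` and `η ∈ H` arbitrary. -/
def ketBraSpan (R : Set H) : Submodule ℂ (compactOps H) :=
  Submodule.span ℂ {T | ∃ ξ ∈ R, ∃ η : H, T = ketBra ξ η}

end Representation

/-! ## The right regular representation -/

section Regular

theorem norm_rpow_two_summable {X : Type*} (f : EllTwo X) :
    Summable fun s => ‖f s‖ ^ (2 : ENNReal).toReal :=
  (lp.memℓp f).summable (by norm_num)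

variable {G : Type*} [Group G]

/-- Right translation `(ρ_t f)(s) = f(st)` on `ℓ²(G)`. -/
def rightShift (t : G) (f : EllTwo G) : EllTwo G :=
  ⟨fun s => f (s * t), memℓp_gen <|
    (Equiv.mulRight t).summable_iff.mpr (norm_rpow_two_summable f)⟩

@[simp] theorem rightShift_apply (t : G) (f : EllTwo G) (s : G) :
    rightShift t f s = f (s * t) := rfl

/-- Right translation as a unitary of `ℓ²(G)`. -/
def rightShiftIso (t : G) : EllTwo G ≃ₗᵢ[ℂ] EllTwo G where
  toFun := rightShift t
  invFun := rightShift t⁻¹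
  map_add' f g := by ext s; simp
  map_smul' c f := by ext s; simp
  left_inv f := by ext s; simp
  right_inv f := by ext s; simp
  norm_map' f := by
    rw [lp.norm_eq_tsum_rpow (by norm_num), lp.norm_eq_tsum_rpow (by norm_num)]
    congr 1
    exact (Equiv.mulRight t).tsum_eq fun s => ‖f s‖ ^ (2 : ENNReal).toReal

variable (G) in
/-- The right regular representation `ρ` of `G` on `ℓ²(G)`. -/
def rightRegular : G →* unitary (EllTwo G →L[ℂ] EllTwo G) where
  toFun t := Unitary.linearIsometryEquiv.symm (rightShiftIso t)
  map_one' := by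
    rw [← map_one Unitary.linearIsometryEquiv.symm]
    congr 1
    ext f s
    change f (s * 1) = f s
    rw [mul_one]
  map_mul' t t' := by
    rw [← map_mul]
    congr 1
    ext f s
    change f (s * (t * t')) = f (s * t * t')
    rw [mul_assoc]

@[simp] theorem rightRegular_apply (t : G) (f : EllTwo G) (s : G) :
    (rightRegular G t : EllTwo G →L[ℂ] EllTwo G) f s = f (s * t) := rfl

end Regular

/-! ## The torus and the Fourier transform -/

/-- The group `ℤ^k`, written multiplicatively. -/
abbrev IntPow (k : ℕ) : Type := Multiplicative (Fin k → ℤ)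

/-- Normalised Haar measure on the torus `𝕋^k = (ℝ/ℤ)^k`. -/
def torusHaar (k : ℕ) : Measure (UnitAddTorus (Fin k)) :=
  Measure.pi fun _ => AddCircle.haarAddCircle

/-- The Fourier transform `ℓ²(ℤ^k) ≅ L²(𝕋^k)`, `ξ ↦ ∑ₙ ξ(n) zⁿ`. -/
def fourierL2 (k : ℕ) : EllTwo (IntPow k) ≃ₗᵢ[ℂ] Lp ℂ 2 (torusHaar k) :=
  (UnitAddTorus.mFourierBasis (d := Fin k)).repr.symm

/-- Smoothness of a function on the torus: its periodic lift to `ℝ^k` is smooth. -/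
def IsSmoothTorus {k : ℕ} (g : UnitAddTorus (Fin k) → ℂ) : Prop :=
  ContDiff ℝ ∞ fun x : Fin k → ℝ => g fun i => (x i : UnitAddCircle)

/-- `R_S`, the preimage of `C_c^∞(S)` under the Fourier transform. (Compactness of the support is
automatic for closed supports, since the torus is compact.) -/
def fourierPreimage {k : ℕ} (S : Set (UnitAddTorus (Fin k))) : Submodule ℂ (EllTwo (IntPow k)) where
  carrier := {ξ | ∃ g : UnitAddTorus (Fin k) → ℂ, IsSmoothTorus g ∧ HasCompactSupport g ∧
    tsupport g ⊆ S ∧ fourierL2 k ξ =ᵐ[torusHaar k] g}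
  zero_mem' := by
    refine ⟨0, contDiff_const, HasCompactSupport.zero, by simp [tsupport], ?_⟩
    rw [map_zero]
    exact Lp.coeFn_zero _ _ _
  add_mem' := by
    rintro ξ η ⟨f, hf, hfc, hfS, hξ⟩ ⟨g, hg, hgc, hgS, hη⟩
    refine ⟨f + g, ContDiff.add hf hg, hfc.add hgc,
      (tsupport_add f g).trans (Set.union_subset hfS hgS), ?_⟩
    rw [map_add]
    exact (Lp.coeFn_add _ _).trans (hξ.add hη)
  smul_mem' := by
    rintro c ξ ⟨g, hg, hgc, hgS, hξ⟩
    refine ⟨c • g, ContDiff.const_smul c hg, hgc.smul_left (f := fun _ => c),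
      (closure_mono (Function.support_const_smul_subset c g)).trans hgS, ?_⟩
    rw [map_smul]
    exact (Lp.coeFn_smul _ _).trans (hξ.const_smul c)

/-- The representation `ρ` of `ℤ^k` on `ℓ²(ℤ^k)`. -/
abbrev rho (k : ℕ) : IntPow k →* unitary (EllTwo (IntPow k) →L[ℂ] EllTwo (IntPow k)) :=
  rightRegular (IntPow k)

/-- The action `Ad ρ` of `ℤ^k` on `K(ℓ²(ℤ^k))`. -/
abbrev adRho (k : ℕ) :
    IntPow k →* (compactOps (EllTwo (IntPow k)) ≃⋆ₐ[ℂ] compactOps (EllTwo (IntPow k))) :=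
  adAction (rho k)

/-- `R_{S,K} = |R_S⟩⟨ℓ²(ℤ^k)| ⊆ K(ℓ²(ℤ^k))`. -/
abbrev compactPreimage {k : ℕ} (S : Set (UnitAddTorus (Fin k))) :
    Submodule ℂ (compactOps (EllTwo (IntPow k))) :=
  ketBraSpan (fourierPreimage S : Set (EllTwo (IntPow k)))

/-- The generalised fixed-point algebra `K(ℓ²(ℤ^k))^{ℤ^k, Ad ρ}` with respect to `R_{S,K}`. -/
abbrev torusFixedPointAlgebra {k : ℕ} (S : Set (UnitAddTorus (Fin k))) :
    NonUnitalStarSubalgebra ℂ 𝓜(ℂ, compactOps (EllTwo (IntPow k))) :=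
  fixedPointAlgebra (adRho k) (compactPreimage S : Set (compactOps (EllTwo (IntPow k))))

/-- `T ∈ L(H)` and `m ∈ M(K(H))` correspond to each other under `M(K(H)) = L(H)`. -/
def Represents {H : Type*} [NormedAddCommGroup H] [InnerProductSpace ℂ H] [CompleteSpace H]
    (m : 𝓜(ℂ, compactOps H)) (T : H →L[ℂ] H) : Prop :=
  ∀ a : compactOps H, (m.fst a : H →L[ℂ] H) = T * a ∧ (m.snd a : H →L[ℂ] H) = a * T

/-- Under the Fourier transform, the operator `T` becomes multiplication by `h`. In this way
`C*_r(ℤ^k) ⊆ L(ℓ²(ℤ^k))` is identified with `C(𝕋^k)`. -/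
def IsFourierMultiplier {k : ℕ} (h : UnitAddTorus (Fin k) → ℂ)
    (T : EllTwo (IntPow k) →L[ℂ] EllTwo (IntPow k)) : Prop :=
  ∀ ξ, fourierL2 k (T ξ) =ᵐ[torusHaar k] fun z => h z * fourierL2 k ξ z

/-- Extension by zero of a function in `C₀(S)` to the whole torus. -/
def extendZero {k : ℕ} {S : Set (UnitAddTorus (Fin k))} (f : C₀(S, ℂ)) :
    UnitAddTorus (Fin k) → ℂ :=
  Function.extend Subtype.val f 0

/-- The Hilbert bimodule `F(R_S)` over `Fix(ℓ²(ℤ^k), R_S)` and `C*_r(ℤ^k) ≅ C(𝕋^k)` is isomorphic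
to the standard bimodule `C₀(S)`, in which all operations are pointwise and the inner products are
`f · conj g` (left) and `conj f · g` (right, with values in the ideal `C₀(S)` of `C(𝕋^k)`):
`Φ` is the isomorphism of modules and `Ψ` the isomorphism of the left coefficient algebra. -/
structure StandardBimoduleIso {k : ℕ} (S : Set (UnitAddTorus (Fin k))) where
  Φ : ketModule (rho k) (fourierPreimage S) ≃ₗᵢ[ℂ] C₀(S, ℂ)
  Ψ : Fix (rho k) (fourierPreimage S) ≃⋆ₐ[ℂ] C₀(S, ℂ)
  left_inner : ∀ V W, ∃ h : (V.1 ∘L ContinuousLinearMap.adjoint W.1) ∈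
      Fix (rho k) (fourierPreimage S),
    Ψ ⟨V.1 ∘L ContinuousLinearMap.adjoint W.1, h⟩ = Φ V * star (Φ W)
  right_inner : ∀ V W, IsFourierMultiplier (extendZero (star (Φ V) * Φ W))
    (ContinuousLinearMap.adjoint V.1 ∘L W.1)
  left_smul : ∀ T V, ∃ h : (T.1 ∘L V.1) ∈
      ketModule (rho k) (fourierPreimage S),
    Φ ⟨T.1 ∘L V.1, h⟩ = Ψ T * Φ V
  right_smul : ∀ V (f : C(UnitAddTorus (Fin k), ℂ)) (T : EllTwo (IntPow k) →L[ℂ] EllTwo (IntPow k)),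
    IsFourierMultiplier f T →
    ∃ h : (V.1 ∘L T) ∈ ketModule (rho k) (fourierPreimage S),
      ∀ z : S, Φ ⟨V.1 ∘L T, h⟩ z = Φ V z * f z

end RieffelProper

end

noncomputable section

namespace RieffelProper

open InnerProductSpace ContinuousLinearMap Filter Topology

/-! ### Compact operators, the map L(H) → M(K(H)), and strict convergence of rank-one sums. -/

section CompactOperators

variable {H E : Type*} [NormedAddCommGroup H] [InnerProductSpace ℂ H] [CompleteSpace H]
  [NormedAddCommGroup E] [InnerProductSpace ℂ E] [CompleteSpace E]

/-! The Fourier transform diagonalises everything. It turns `ρ_t` into multiplication by `z^{-t}`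
(`rho_eq_fourierMul`). If `ξ` has a continuous transform `g`, then `|ξ⟩⟩` sends `δ_t` to the vector
with transform `z^t g`, so `|ξ⟩⟩` is multiplication by `g` (`isKet_rho_iff`) and `|ξ⟩⟩⟨⟨η|` is
multiplication by `g · conj h`, where `h` is the transform of `η`. The sum of the translates of
`|ξ⟩⟨η|` is `|ξ⟩⟩⟨⟨η|` in the strict topology: the finite partial sums are uniformly bounded by
Bessel's inequality, so convergence need only be checked against rank-one operators
(`hasSum_rankOne_mul`, `isStrictIntegral_ketBra`).

Thus the fixed-point algebra, `Fix` and `F(R_S)` are all generated by Fourier multipliers with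
symbol in `C_c^∞(S)`. This space is uniformly dense in `C₀(S)`, each of its elements is a product of
two of them by a local unit, and injective `*`-homomorphisms of C*-algebras are isometric with
closed range. Each of the three closures is therefore a faithful copy of `C₀(S)`
(`coe_closure_adjoin_eq_range`, `coe_closure_span_eq_range`), and the bimodule axioms become
pointwise identities between functions.

Two analytic facts remain. The coefficient `⟨ξ, ρ_t η⟩` is the `t`-th Fourier coefficient of a
smooth function, hence absolutely summable (`IsSmoothTorus.summable`). And `R_S` is dense because
multiplication by a continuous function with zero set the complement of `S`, a null set, has dense
range (`dense_fourierPreimage`).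

For the second statement, `n + 1` parallel subtori are removed from the torus, which leaves `n + 1`
connected slabs. The largest number of nonzero, mutually annihilating pieces into which `C₀(S)`
decomposes is then `n + 1`, and this number is an invariant of the ring. -/

theorem mul_left_mem_compactOps (T : H →L[ℂ] H) {a : H →L[ℂ] H} (ha : a ∈ compactOps H) :
    T * a ∈ compactOps H := by
  refine map_mem_closure (f := fun a => T * a) (by fun_prop) ha fun b hb => ?_
  change b ∈ Submodule.span ℂ _ at hb
  change T * b ∈ Submodule.span ℂ _
  induction hb using Submodule.span_induction with
  | zero => simp
  | add x y _ _ hx hy => rw [mul_add]; exact add_mem hx hy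
  | smul c x _ hx => rw [mul_smul_comm]; exact Submodule.smul_mem _ c hx
  | mem x hx =>
    obtain ⟨ξ, η, rfl⟩ := hx
    exact Submodule.subset_span ⟨T ξ, η, by rw [mul_def, comp_rankOne]⟩

theorem mul_right_mem_compactOps (T : H →L[ℂ] H) {a : H →L[ℂ] H} (ha : a ∈ compactOps H) :
    a * T ∈ compactOps H := by
  have h := star_mem (mul_left_mem_compactOps (star T) (star_mem ha))
  rwa [star_mul, star_star, star_star] at h

/-- Left multiplication by `T ∈ L(H)` on `K(H)`. -/
def compactMulLeft (T : H →L[ℂ] H) : compactOps H →L[ℂ] compactOps H :=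
  LinearMap.mkContinuous
    { toFun := fun a => ⟨T * a, mul_left_mem_compactOps T a.2⟩
      map_add' := fun a b => Subtype.ext (mul_add T a.1 b.1)
      map_smul' := fun c a => Subtype.ext (mul_smul_comm c T a.1) } ‖T‖
    fun a => norm_mul_le T a.1

/-- Right multiplication by `T ∈ L(H)` on `K(H)`. -/
def compactMulRight (T : H →L[ℂ] H) : compactOps H →L[ℂ] compactOps H :=
  LinearMap.mkContinuous
    { toFun := fun a => ⟨a * T, mul_right_mem_compactOps T a.2⟩
      map_add' := fun a b => Subtype.ext (add_mul a.1 b.1 T)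
      map_smul' := fun c a => Subtype.ext (smul_mul_assoc c a.1 T) } ‖T‖
    fun a => (norm_mul_le a.1 T).trans_eq (mul_comm _ _)

theorem multiplier_ext {m m' : 𝓜(ℂ, compactOps H)} (h : ∀ a, m.fst a = m'.fst a)
    (h' : ∀ a, m.snd a = m'.snd a) : m = m' :=
  DoubleCentralizer.ext _ _ _ _ (Prod.ext (ContinuousLinearMap.ext h) (ContinuousLinearMap.ext h'))

/-- The canonical map `L(H) → M(K(H))`. -/
def multiplierOfOperator : (H →L[ℂ] H) →⋆ₙₐ[ℂ] 𝓜(ℂ, compactOps H) where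
  toFun T := ⟨(compactMulLeft T, compactMulRight T), fun x y => Subtype.ext (mul_assoc _ _ _)⟩
  map_smul' c T := multiplier_ext (fun a => Subtype.ext (smul_mul_assoc c T a.1))
    fun a => Subtype.ext (mul_smul_comm c a.1 T)
  map_zero' := multiplier_ext (fun a => Subtype.ext (zero_mul a.1))
    fun a => Subtype.ext (mul_zero a.1)
  map_add' S T := multiplier_ext (fun a => Subtype.ext (add_mul S T a.1))
    fun a => Subtype.ext (mul_add a.1 S T)
  map_mul' S T := multiplier_ext (fun a => Subtype.ext (mul_assoc S T a.1))
    fun a => Subtype.ext (mul_assoc a.1 S T).symm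
  map_star' T := multiplier_ext
    (fun a => Subtype.ext (by
      rw [DoubleCentralizer.star_fst]
      change star T * a.1 = star (star a.1 * T)
      rw [star_mul, star_star]))
    (fun a => Subtype.ext (by
      rw [DoubleCentralizer.star_snd]
      change a.1 * star T = star (T * star a.1)
      rw [star_mul, star_star]))

theorem represents_multiplierOfOperator (T : H →L[ℂ] H) :
    Represents (multiplierOfOperator T) T := fun _ => ⟨rfl, rfl⟩

@[simp] theorem coe_ketBra (ξ η : H) : (ketBra ξ η : H →L[ℂ] H) = rankOne ℂ ξ η := rfl

theorem norm_ketBra (ξ η : H) : ‖ketBra ξ η‖ = ‖ξ‖ * ‖η‖ := norm_rankOne ξ η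

theorem star_ketBra (ξ η : H) : star (ketBra ξ η) = ketBra η ξ :=
  Subtype.ext (by
    change star (rankOne ℂ ξ η) = _
    rw [star_eq_adjoint, adjoint_rankOne, coe_ketBra])

theorem ketBra_mul_ketBra (ξ η ξ' η' : H) :
    ketBra ξ η * ketBra ξ' η' = ⟪η, ξ'⟫_ℂ • ketBra ξ η' :=
  Subtype.ext (rankOne_comp_rankOne ξ η ξ' η')

theorem compactMulLeft_ketBra (T : H →L[ℂ] H) (ξ η : H) :
    compactMulLeft T (ketBra ξ η) = ketBra (T ξ) η :=
  Subtype.ext (comp_rankOne ξ η T)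

theorem compactMulRight_ketBra (T : H →L[ℂ] H) (ξ η : H) :
    compactMulRight T (ketBra ξ η) = ketBra ξ (star T η) :=
  Subtype.ext (rankOne_comp ξ η T)

/-- For `x ≠ 0` the operator `T|x⟩⟨x|` sends `x` to `‖x‖² T x`, so the action of `T` on compact
operators determines `T`. -/
theorem multiplierOfOperator_injective :
    Function.Injective (multiplierOfOperator : (H →L[ℂ] H) →⋆ₙₐ[ℂ] 𝓜(ℂ, compactOps H)) := by
  intro S T h
  ext x
  rcases eq_or_ne x 0 with rfl | hx
  · simp
  have h1 : (compactMulLeft S (ketBra x x) : H →L[ℂ] H) x =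
      (compactMulLeft T (ketBra x x) : H →L[ℂ] H) x := by
    change (((multiplierOfOperator S).fst (ketBra x x) : compactOps H) : H →L[ℂ] H) x = _
    rw [h]
    rfl
  rw [compactMulLeft_ketBra, compactMulLeft_ketBra] at h1
  simpa [hx] using h1

theorem continuous_ketBra_left (η : H) : Continuous fun ξ : H => ketBra ξ η :=
  ((rankOne ℂ (E := H) (F := H)).flip η).continuous.subtype_mk _

theorem continuous_ketBra_right (ξ : H) : Continuous fun η : H => ketBra ξ η :=
  (rankOne ℂ ξ).continuous.subtype_mk _

theorem coe_adAction {G : Type*} [Group G] (u : G →* unitary (H →L[ℂ] H)) (t : G)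
    (a : compactOps H) :
    (adAction u t a : H →L[ℂ] H) = (u t : H →L[ℂ] H) * a * star (u t : H →L[ℂ] H) := rfl

theorem adAction_ketBra {G : Type*} [Group G] (u : G →* unitary (H →L[ℂ] H)) (t : G) (ξ η : H) :
    adAction u t (ketBra ξ η) = ketBra ((u t : H →L[ℂ] H) ξ) ((u t : H →L[ℂ] H) η) :=
  Subtype.ext (by
    rw [coe_adAction, coe_ketBra, mul_def, mul_def, comp_rankOne, rankOne_comp,
      ← star_eq_adjoint, star_star, coe_ketBra])

/-- The span of the rank-one operators with entries in dense sets is dense in `K(H)`. -/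
theorem dense_span_ketBra {R R' : Set H} (hR : Dense R) (hR' : Dense R') :
    Dense (Submodule.span ℂ {T : compactOps H | ∃ ξ ∈ R, ∃ η ∈ R', T = ketBra ξ η} :
      Set (compactOps H)) := by
  set M := Submodule.span ℂ {T : compactOps H | ∃ ξ ∈ R, ∃ η ∈ R', T = ketBra ξ η} with hM
  have h1 : ∀ ξ η : H, ketBra ξ η ∈ M.topologicalClosure := by
    intro ξ η
    have h0 : ∀ x ∈ R, ketBra x η ∈ M.topologicalClosure := fun x hx =>
      map_mem_closure (continuous_ketBra_right x) (hR' η)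
        fun y hy => Submodule.subset_span ⟨x, hx, y, hy, rfl⟩
    rw [← SetLike.mem_coe, ← M.isClosed_topologicalClosure.closure_eq]
    exact map_mem_closure (f := fun x : H => ketBra x η) (continuous_ketBra_left η) (hR ξ) h0
  have h2 : ∀ a ∈ finiteRank H, ∀ ha' : a ∈ compactOps H,
      (⟨a, ha'⟩ : compactOps H) ∈ M.topologicalClosure := by
    intro a ha
    change a ∈ Submodule.span ℂ _ at ha
    induction ha using Submodule.span_induction with
    | zero => intro _; exact zero_mem _
    | add x y hx hy hx' hy' =>
      intro _
      exact add_mem (hx' ((finiteRank H).le_topologicalClosure hx))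
        (hy' ((finiteRank H).le_topologicalClosure hy))
    | smul c x hx hx' =>
      intro _
      exact Submodule.smul_mem _ c (hx' ((finiteRank H).le_topologicalClosure hx))
    | mem x hx =>
      obtain ⟨ξ, η, rfl⟩ := hx
      exact fun _ => h1 ξ η
  intro a
  rw [← Submodule.topologicalClosure_coe]
  -- The density of finite-rank operators is known in L(H); it is transported to the subspace
  -- topology of K(H).
  have h3 : a ∈ closure {b : compactOps H | (b : H →L[ℂ] H) ∈ finiteRank H} := by
    rw [closure_subtype]
    refine closure_mono ?_ a.2
    exact fun b hb => ⟨⟨b, (finiteRank H).le_topologicalClosure hb⟩, hb, rfl⟩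
  refine closure_minimal (fun b hb => h2 b.1 hb b.2) M.isClosed_topologicalClosure h3

/-- The operators against which a uniformly bounded family of operators converges form a closed
set. -/
theorem isClosed_setOf_tendsto_mul {ι A : Type*} [NonUnitalNormedRing A] {l : Filter ι} {T : ι → A}
    {S : A} {C : ℝ} (hT : ∀ i, ‖T i‖ ≤ C) :
    IsClosed {a : A | Tendsto (fun i => T i * a) l (𝓝 (S * a))} := by
  rw [← closure_subset_iff_isClosed]
  intro a ha
  rw [Set.mem_ofPred_eq, Metric.tendsto_nhds]
  intro ε hε
  -- Replacing `a` by a nearby `b` costs at most `(|C| + ‖S‖)‖a - b‖`, uniformly in `i`; the extra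
  -- `1` keeps the divisor positive.
  have hC : 0 < |C| + ‖S‖ + 1 := by positivity
  obtain ⟨b, hb, hab⟩ := Metric.mem_closure_iff.1 ha (ε / 2 / (|C| + ‖S‖ + 1)) (by positivity)
  filter_upwards [(Metric.tendsto_nhds.1 hb) (ε / 2) (by positivity)] with i hi
  rw [dist_eq_norm] at hi hab ⊢
  have e : T i * a - S * a = T i * (a - b) + (T i * b - S * b) - S * (a - b) := by
    simp only [mul_sub]; abel
  have h1 : ‖T i * (a - b)‖ ≤ |C| * ‖a - b‖ :=
    (norm_mul_le _ _).trans (by gcongr; exact (hT i).trans (le_abs_self C))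
  have h2 : ‖S * (a - b)‖ ≤ ‖S‖ * ‖a - b‖ := norm_mul_le _ _
  have h3 : (|C| + ‖S‖ + 1) * ‖a - b‖ < ε / 2 := by rwa [lt_div_iff₀' hC] at hab
  calc ‖T i * a - S * a‖ ≤ ‖T i * (a - b)‖ + ‖T i * b - S * b‖ + ‖S * (a - b)‖ := by
        rw [e]; exact (norm_sub_le _ _).trans (by gcongr; exact norm_add_le _ _)
    _ < ε := by nlinarith [norm_nonneg (a - b)]

/-- The partial sum is `V P W*` with `P` the projection onto the span of finitely many basis
vectors, and `‖P‖ ≤ 1` by Bessel. The bound does not depend on `s`, which is what allows convergence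
to pass to limits of finite-rank operators. -/
theorem norm_sum_rankOne_le {ι : Type*} (b : HilbertBasis ι ℂ E) (V W : E →L[ℂ] H)
    (s : Finset ι) : ‖∑ i ∈ s, rankOne ℂ (V (b i)) (W (b i))‖ ≤ ‖V‖ * ‖W‖ := by
  refine opNorm_le_bound _ (by positivity) fun x => ?_
  have e : (∑ i ∈ s, rankOne ℂ (V (b i)) (W (b i))) x
      = V (∑ i ∈ s, ⟪b i, adjoint W x⟫_ℂ • b i) := by
    simp [sum_apply, map_sum, adjoint_inner_right]
  have h2 : ‖∑ i ∈ s, ⟪b i, adjoint W x⟫_ℂ • b i‖ ≤ ‖adjoint W x‖ := by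
    refine (sq_le_sq₀ (norm_nonneg _) (norm_nonneg _)).1 ?_
    have h3 : ‖∑ i ∈ s, ⟪b i, adjoint W x⟫_ℂ • b i‖ ^ 2 = ∑ i ∈ s, ‖⟪b i, adjoint W x⟫_ℂ‖ ^ 2 := by
      rw [← Complex.ofReal_inj, Complex.ofReal_pow, ← RCLike.ofReal_eq_complex_ofReal,
        ← inner_self_eq_norm_sq_to_K, b.orthonormal.inner_sum]
      push_cast
      exact Finset.sum_congr rfl fun i _ => Complex.conj_mul' _
    rw [h3]
    exact b.orthonormal.sum_inner_products_le _
  calc _ ≤ ‖V‖ * ‖∑ i ∈ s, ⟪b i, adjoint W x⟫_ℂ • b i‖ := by rw [e]; exact V.le_opNorm _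
    _ ≤ ‖V‖ * (‖W‖ * ‖x‖) := by
        gcongr
        exact h2.trans (((adjoint W).le_opNorm x).trans_eq (by rw [LinearIsometryEquiv.norm_map]))
    _ = _ := by ring

/-- For a Hilbert basis `b`, the operators `|V bᵢ⟩⟨W bᵢ|` sum to `V W*` against compact operators. -/
theorem hasSum_rankOne_mul {ι : Type*} (b : HilbertBasis ι ℂ E) (V W : E →L[ℂ] H)
    {a : H →L[ℂ] H} (ha : a ∈ compactOps H) :
    HasSum (fun i => rankOne ℂ (V (b i)) (W (b i)) * a) (V ∘L adjoint W * a) := by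
  have key : (compactOps H : Set (H →L[ℂ] H)) ⊆ {a : H →L[ℂ] H | Tendsto
      (fun s : Finset ι => (∑ i ∈ s, rankOne ℂ (V (b i)) (W (b i))) * a) atTop
      (𝓝 (V ∘L adjoint W * a))} := by
    refine closure_minimal ?_ (isClosed_setOf_tendsto_mul (norm_sum_rankOne_le b V W))
    intro c hc
    change c ∈ Submodule.span ℂ _ at hc
    induction hc using Submodule.span_induction with
    | zero => simp
    | add x y _ _ hx hy =>
      simp only [Set.mem_ofPred_eq, mul_add] at hx hy ⊢
      exact hx.add hy
    | smul c x _ hx =>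
      simp only [Set.mem_ofPred_eq, mul_smul_comm] at hx ⊢
      exact hx.const_smul c
    | mem x hx =>
      obtain ⟨ξ, η, rfl⟩ := hx
      have h1 : HasSum (fun i => rankOne ℂ (V (b i)) (W (b i)) ξ) (V (adjoint W ξ)) := by
        simpa [b.repr_apply_apply, adjoint_inner_right] using
          V.hasSum (b.hasSum_repr (adjoint W ξ))
      have h2 := ((rankOne ℂ (E := H) (F := H)).flip η).hasSum h1
      simp only [Set.mem_ofPred_eq, Finset.sum_mul, mul_def, comp_rankOne]
      exact h2
  have := key ha
  simp only [Set.mem_ofPred_eq, Finset.sum_mul] at this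
  exact this

end CompactOperators

end RieffelProper

end

noncomputable section

namespace RieffelProper

open ContinuousLinearMap Filter Topology

/-! ### Multiplication by continuous functions on L². -/

section MultiplicationOperators

variable {X : Type*} [TopologicalSpace X] [CompactSpace X] [MeasurableSpace X] {μ : Measure X}

theorem ae_norm_mul_le (f : C(X, ℂ)) (ψ : X → ℂ) : ∀ᵐ x ∂μ, ‖f x * ψ x‖ ≤ ‖f‖ * ‖ψ x‖ :=
  .of_forall fun x => by rw [norm_mul]; gcongr; exact f.norm_coe_le_norm x

variable [OpensMeasurableSpace X]

theorem memLp_continuous_mul (f : C(X, ℂ)) (ψ : Lp ℂ 2 μ) : MemLp (fun x => f x * ψ x) 2 μ :=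
  (Lp.memLp ψ).of_le_mul (f.continuous.aestronglyMeasurable.mul (Lp.aestronglyMeasurable ψ))
    (ae_norm_mul_le f ψ)

/-- Multiplication by a continuous function as an operator on `L²`. -/
def mulLp (f : C(X, ℂ)) : Lp ℂ 2 μ →L[ℂ] Lp ℂ 2 μ :=
  LinearMap.mkContinuous
    { toFun := fun ψ => (memLp_continuous_mul f ψ).toLp
      map_add' := fun φ ψ => by
        ext1
        filter_upwards [(memLp_continuous_mul f (φ + ψ)).coeFn_toLp, Lp.coeFn_add φ ψ,
          Lp.coeFn_add (memLp_continuous_mul f φ).toLp (memLp_continuous_mul f ψ).toLp,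
          (memLp_continuous_mul f φ).coeFn_toLp,
          (memLp_continuous_mul f ψ).coeFn_toLp] with x h1 h2 h3 h4 h5
        rw [h1, h3, Pi.add_apply, h2, h4, h5, Pi.add_apply, mul_add]
      map_smul' := fun c ψ => by
        ext1
        filter_upwards [(memLp_continuous_mul f (c • ψ)).coeFn_toLp, Lp.coeFn_smul c ψ,
          Lp.coeFn_smul c (memLp_continuous_mul f ψ).toLp,
          (memLp_continuous_mul f ψ).coeFn_toLp] with x h1 h2 h3 h4
        rw [RingHom.id_apply, h1, h3, Pi.smul_apply, h2, h4, Pi.smul_apply, mul_smul_comm] }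
    ‖f‖ fun ψ => Lp.norm_le_mul_norm_of_ae_le_mul (by
      filter_upwards [(memLp_continuous_mul f ψ).coeFn_toLp, ae_norm_mul_le f ψ] with x h1 h2
      exact h1 ▸ h2)

theorem coeFn_mulLp (f : C(X, ℂ)) (ψ : Lp ℂ 2 μ) : mulLp f ψ =ᵐ[μ] fun x => f x * ψ x :=
  (memLp_continuous_mul f ψ).coeFn_toLp

end MultiplicationOperators

/-! ### Fourier multipliers, the regular representation and the operators |ξ⟩⟩. -/

section Fourier

variable {k : ℕ}

instance : IsProbabilityMeasure (torusHaar k) :=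
  inferInstanceAs (IsProbabilityMeasure (Measure.pi fun _ => AddCircle.haarAddCircle))

instance : (torusHaar k).IsAddHaarMeasure :=
  inferInstanceAs (Measure.pi fun _ => AddCircle.haarAddCircle).IsAddHaarMeasure

theorem fourierL2_single (n : IntPow k) [hdec : DecidableEq (IntPow k)] :
    fourierL2 k (lp.single 2 n (1 : ℂ)) =ᵐ[torusHaar k] UnitAddTorus.mFourier n.toAdd := by
  have h : fourierL2 k (lp.single 2 n (1 : ℂ)) = UnitAddTorus.mFourierLp 2 n.toAdd := by
    rw [← UnitAddTorus.coe_mFourierBasis]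
    let _ : DecidableEq (Fin k → ℤ) := Classical.decEq _
    rw [← UnitAddTorus.mFourierBasis.repr_symm_single]
    obtain rfl : hdec = Classical.decEq _ := Subsingleton.elim _ _
    rfl
  rw [h]
  exact UnitAddTorus.coeFn_mFourierLp 2 n.toAdd

/-- Every `f` is the norm-convergent sum of its components `f(t) δ_t`. -/
theorem ellTwo_clm_ext {G F : Type*} [DecidableEq G] [NormedAddCommGroup F] [NormedSpace ℂ F]
    {S T : EllTwo G →L[ℂ] F} (h : ∀ t, S (lp.single 2 t 1) = T (lp.single 2 t 1)) : S = T := by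
  ext f
  have e : ∀ t, lp.single 2 t (f t) = f t • (lp.single 2 t (1 : ℂ) : EllTwo G) := fun t => by
    rw [← lp.single_smul, smul_eq_mul, mul_one]
  have hf := lp.hasSum_single (p := 2) (by norm_num) f
  refine (S.hasSum hf).unique ?_
  convert! T.hasSum hf using 2 with t
  rw [e, map_smul, map_smul, h]

theorem IsFourierMultiplier.unique {h : UnitAddTorus (Fin k) → ℂ}
    {S T : EllTwo (IntPow k) →L[ℂ] EllTwo (IntPow k)} (hS : IsFourierMultiplier h S)
    (hT : IsFourierMultiplier h T) : S = T := by
  ext1 ξ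
  refine (fourierL2 k).injective ?_
  ext1
  exact (hS ξ).trans (hT ξ).symm

/-- The operator that becomes multiplication by `f` under the Fourier transform. -/
def fourierMulAux (f : C(UnitAddTorus (Fin k), ℂ)) : EllTwo (IntPow k) →L[ℂ] EllTwo (IntPow k) :=
  ((fourierL2 k).symm.toContinuousLinearEquiv : _ →L[ℂ] _) ∘L mulLp (μ := torusHaar k) f ∘L
    ((fourierL2 k).toContinuousLinearEquiv : _ →L[ℂ] _)

theorem isFourierMultiplier_fourierMulAux (f : C(UnitAddTorus (Fin k), ℂ)) :
    IsFourierMultiplier f (fourierMulAux f) := by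
  intro ξ
  have : fourierL2 k (fourierMulAux f ξ) = mulLp f (fourierL2 k ξ) :=
    (fourierL2 k).apply_symm_apply _
  rw [this]
  exact coeFn_mulLp f _

/-- The representation of `C(𝕋^k)` on `ℓ²(ℤ^k)` by Fourier multipliers. -/
def fourierMul (k : ℕ) :
    C(UnitAddTorus (Fin k), ℂ) →⋆ₙₐ[ℂ] (EllTwo (IntPow k) →L[ℂ] EllTwo (IntPow k)) where
  toFun := fourierMulAux
  map_smul' c f := (isFourierMultiplier_fourierMulAux _).unique fun ξ => by
    have e : fourierL2 k ((c • fourierMulAux f) ξ) = c • fourierL2 k (fourierMulAux f ξ) :=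
      map_smul (fourierL2 k) c _
    rw [MonoidHom.id_apply, e]
    filter_upwards [Lp.coeFn_smul c (fourierL2 k (fourierMulAux f ξ)),
      isFourierMultiplier_fourierMulAux f ξ] with x h1 h2
    rw [h1, Pi.smul_apply, h2, ContinuousMap.smul_apply, smul_mul_assoc]
  map_zero' := (isFourierMultiplier_fourierMulAux _).unique fun ξ => by
    rw [zero_apply, map_zero]
    filter_upwards [Lp.coeFn_zero ℂ 2 (torusHaar k)] with x h1
    rw [h1, ContinuousMap.zero_apply, zero_mul, Pi.zero_apply]
  map_add' f g := (isFourierMultiplier_fourierMulAux _).unique fun ξ => by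
    rw [add_apply, map_add]
    filter_upwards [Lp.coeFn_add (fourierL2 k (fourierMulAux f ξ)) (fourierL2 k (fourierMulAux g ξ)),
      isFourierMultiplier_fourierMulAux f ξ, isFourierMultiplier_fourierMulAux g ξ] with x h1 h2 h3
    rw [h1, Pi.add_apply, h2, h3, ContinuousMap.add_apply, add_mul]
  map_mul' f g := (isFourierMultiplier_fourierMulAux _).unique fun ξ => by
    filter_upwards [isFourierMultiplier_fourierMulAux f (fourierMulAux g ξ),
      isFourierMultiplier_fourierMulAux g ξ] with x h1 h2
    rw [mul_apply_eq_comp, h1, h2, ContinuousMap.mul_apply, mul_assoc]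
  map_star' f := by
    rw [star_eq_adjoint, eq_adjoint_iff]
    intro ξ η
    rw [← (fourierL2 k).inner_map_map, ← (fourierL2 k).inner_map_map, L2.inner_def, L2.inner_def]
    refine integral_congr_ae ?_
    filter_upwards [isFourierMultiplier_fourierMulAux (star f) ξ,
      isFourierMultiplier_fourierMulAux f η] with x h1 h2
    rw [h1, h2]
    simp only [RCLike.inner_apply, map_mul, ContinuousMap.star_apply, RCLike.star_def,
      starRingEnd_self_apply]
    ring

theorem isFourierMultiplier_fourierMul (f : C(UnitAddTorus (Fin k), ℂ)) :
    IsFourierMultiplier f (fourierMul k f) :=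
  isFourierMultiplier_fourierMulAux f

theorem IsFourierMultiplier.eq_fourierMul {f : C(UnitAddTorus (Fin k), ℂ)}
    {T : EllTwo (IntPow k) →L[ℂ] EllTwo (IntPow k)} (h : IsFourierMultiplier f T) :
    T = fourierMul k f :=
  h.unique (isFourierMultiplier_fourierMul f)

/-- Applied to the delta function at the identity, whose transform is the constant `1`, the operator
returns its own symbol almost everywhere; Haar measure has full support, so continuous symbols are
then equal everywhere. -/
theorem fourierMul_injective : Function.Injective (fourierMul k) := by
  classical
  intro f g h
  refine DFunLike.coe_injective
    (Continuous.ae_eq_iff_eq (torusHaar k) f.continuous g.continuous |>.1 ?_)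
  have hf := isFourierMultiplier_fourierMul f (lp.single 2 1 1)
  have hg := isFourierMultiplier_fourierMul g (lp.single 2 1 1)
  rw [h] at hf
  filter_upwards [hf, hg, fourierL2_single (k := k) 1] with x h1 h2 h3
  rw [h1, h3, toAdd_one, UnitAddTorus.mFourier_zero] at h2
  simpa using h2

/-- In additive notation `ρ_t δ_n = δ_{n-t}`, which on the Fourier side is `z^n ↦ z^{n-t}`. As
multiplication operators commute, every Fourier multiplier is consequently `Ad ρ`-invariant. -/
theorem rho_eq_fourierMul (t : IntPow k) :
    (rho k t : EllTwo (IntPow k) →L[ℂ] EllTwo (IntPow k)) =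
      fourierMul k (UnitAddTorus.mFourier (-t.toAdd)) := by
  classical
  refine ellTwo_clm_ext fun n => ?_
  have h : (rho k t : EllTwo (IntPow k) →L[ℂ] EllTwo (IntPow k)) (lp.single 2 n 1) =
      lp.single 2 (n * t⁻¹) 1 := by
    ext s
    rw [rightRegular_apply, lp.single_apply, lp.single_apply, Pi.single_apply, Pi.single_apply]
    simp only [eq_mul_inv_iff_mul_eq]
  rw [h]
  refine (fourierL2 k).injective ?_
  ext1
  filter_upwards [fourierL2_single (n * t⁻¹), fourierL2_single n,
    isFourierMultiplier_fourierMul (UnitAddTorus.mFourier (-t.toAdd)) (lp.single 2 n 1)]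
    with x h1 h2 h3
  rw [h1, h3, h2, toAdd_mul, toAdd_inv, UnitAddTorus.mFourier_add, mul_comm]

theorem fourierL2_rho (t : IntPow k) (ξ : EllTwo (IntPow k)) :
    fourierL2 k ((rho k t : EllTwo (IntPow k) →L[ℂ] EllTwo (IntPow k)) ξ) =ᵐ[torusHaar k]
      fun x => UnitAddTorus.mFourier (-t.toAdd) x * fourierL2 k ξ x := by
  rw [rho_eq_fourierMul]
  exact isFourierMultiplier_fourierMul _ ξ

/-- `IsKet` fixes the classical decidability instance inside `lp.single`; this frees the statement
from that choice. -/
theorem isKet_iff {G H : Type*} [Group G] [NormedAddCommGroup H] [InnerProductSpace ℂ H]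
    [CompleteSpace H] [DecidableEq G] {u : G →* unitary (H →L[ℂ] H)} {ξ : H} {V : EllTwo G →L[ℂ] H} :
    IsKet u ξ V ↔ ∀ t, V (lp.single 2 t 1) = (u t⁻¹ : H →L[ℂ] H) ξ := by
  unfold IsKet
  congr!

/-- If the Fourier transform of `ξ` is a continuous function `g`, then `ξ` is square integrable and
`|ξ⟩⟩` is multiplication by `g`. -/
theorem isKet_rho_iff {ξ : EllTwo (IntPow k)} {g : C(UnitAddTorus (Fin k), ℂ)}
    (h : fourierL2 k ξ =ᵐ[torusHaar k] g) (V : EllTwo (IntPow k) →L[ℂ] EllTwo (IntPow k)) :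
    IsKet (rho k) ξ V ↔ V = fourierMul k g := by
  classical
  -- Both operators send `δ_t` to the vector with transform `z^t g`, since `ρ_{-t}` is
  -- multiplication by `z^t`.
  have key : IsKet (rho k) ξ (fourierMul k g) := by
    refine isKet_iff.2 fun t => ?_
    refine (fourierL2 k).injective ?_
    ext1
    filter_upwards [h, fourierL2_rho t⁻¹ ξ, isFourierMultiplier_fourierMul g (lp.single 2 t 1),
      fourierL2_single t] with x h1 h2 h3 h4
    rw [h2, h3, h4, h1, toAdd_inv, neg_neg, mul_comm]
  refine ⟨fun hV => ellTwo_clm_ext fun t => ?_, fun hV => hV ▸ key⟩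
  exact (isKet_iff.1 hV t).trans (isKet_iff.1 key t).symm

theorem hasSum_coe_compactOps {ι H : Type*} [NormedAddCommGroup H] [InnerProductSpace ℂ H]
    [CompleteSpace H] {f : ι → compactOps H} {a : compactOps H} :
    HasSum (fun i => (f i : H →L[ℂ] H)) (a : H →L[ℂ] H) ↔ HasSum f a :=
  Topology.IsInducing.subtypeVal.hasSum_iff (g := AddSubmonoidClass.subtype (compactOps H)) f a

theorem coe_mul_compactOps {H : Type*} [NormedAddCommGroup H] [InnerProductSpace ℂ H]
    [CompleteSpace H] (a b : compactOps H) : ((a * b : compactOps H) : H →L[ℂ] H) = a * b := rfl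

/-- The strict-unconditional sum of `t ↦ u_t |ξ⟩⟨η| u_t*` is `|ξ⟩⟩⟨⟨η|`. -/
theorem isStrictIntegral_ketBra {G H : Type*} [Group G] [NormedAddCommGroup H]
    [InnerProductSpace ℂ H]
    [CompleteSpace H] {u : G →* unitary (H →L[ℂ] H)} {ξ η : H}
    {V W : EllTwo G →L[ℂ] H} (hV : IsKet u ξ V) (hW : IsKet u η W) :
    IsStrictIntegral (fun t => adAction u t (ketBra ξ η))
      (multiplierOfOperator (V ∘L adjoint W)) := by
  classical
  obtain ⟨b, hb⟩ : ∃ b : HilbertBasis G ℂ (EllTwo G), ∀ t, b t = lp.single 2 t 1 :=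
    ⟨.ofRepr (.refl ℂ _), fun t => (HilbertBasis.repr_symm_single _ t).symm⟩
  have key : ∀ {ξ η : H} {V W : EllTwo G →L[ℂ] H}, IsKet u ξ V → IsKet u η W →
      ∀ a ∈ compactOps H, HasSum (fun t => InnerProductSpace.rankOne ℂ ((u t : H →L[ℂ] H) ξ)
        ((u t : H →L[ℂ] H) η) * a) (V ∘L adjoint W * a) := by
    intro ξ η V W hV hW a ha
    -- As `V δ_t = u_{t⁻¹} ξ`, the sum over the basis runs over inverses and has to be reindexed.
    have h := (Equiv.inv G).hasSum_iff.2 (hasSum_rankOne_mul b V W ha)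
    refine h.congr_fun fun t => ?_
    rw [Function.comp_apply, Equiv.inv_apply, hb, isKet_iff.1 hV, isKet_iff.1 hW, inv_inv]
  refine fun a => ⟨hasSum_coe_compactOps.1 ?_, hasSum_coe_compactOps.1 ?_⟩
  · refine (key hV hW a.1 a.2).congr_fun fun t => ?_
    beta_reduce
    rw [coe_mul_compactOps, adAction_ketBra, coe_ketBra]
  -- Right multiplication is the adjoint of left multiplication by `a*` with the roles of `ξ` and
  -- `η` exchanged.
  · have h := (key hW hV (star a.1) (star_mem a.2)).star
    have e : star (W ∘L adjoint V) = V ∘L adjoint W := by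
      rw [star_eq_adjoint, adjoint_comp, adjoint_adjoint]
    rw [star_mul, star_star, e] at h
    refine h.congr_fun fun t => ?_
    beta_reduce
    rw [coe_mul_compactOps, adAction_ketBra, coe_ketBra, star_mul, star_star, star_eq_adjoint,
      InnerProductSpace.adjoint_rankOne]

end Fourier

end RieffelProper

end

noncomputable section

namespace RieffelProper

open Filter Topology

variable {k : ℕ}

/-! ## Smooth functions on the torus -/

/-- The quotient map `ℝ^k → 𝕋^k`. -/
def torusProj (x : Fin k → ℝ) : UnitAddTorus (Fin k) := fun i => (x i : UnitAddCircle)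

theorem isOpenQuotientMap_torusProj : IsOpenQuotientMap (torusProj (k := k)) :=
  .piMap fun _ => QuotientAddGroup.isOpenQuotientMap_mk

theorem isSmoothTorus_iff {g : UnitAddTorus (Fin k) → ℂ} :
    IsSmoothTorus g ↔ ContDiff ℝ ∞ (g ∘ torusProj) := Iff.rfl

theorem IsSmoothTorus.continuous {g : UnitAddTorus (Fin k) → ℂ} (hg : IsSmoothTorus g) :
    Continuous g :=
  isOpenQuotientMap_torusProj.isQuotientMap.continuous_iff.2 (ContDiff.continuous hg)

theorem IsSmoothTorus.mul {f g : UnitAddTorus (Fin k) → ℂ} (hf : IsSmoothTorus f)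
    (hg : IsSmoothTorus g) : IsSmoothTorus (f * g) :=
  ContDiff.mul hf hg

theorem IsSmoothTorus.add {f g : UnitAddTorus (Fin k) → ℂ} (hf : IsSmoothTorus f)
    (hg : IsSmoothTorus g) : IsSmoothTorus (f + g) :=
  ContDiff.add hf hg

theorem IsSmoothTorus.sub {f g : UnitAddTorus (Fin k) → ℂ} (hf : IsSmoothTorus f)
    (hg : IsSmoothTorus g) : IsSmoothTorus (f - g) :=
  ContDiff.sub hf hg

theorem IsSmoothTorus.const_smul {g : UnitAddTorus (Fin k) → ℂ} (hg : IsSmoothTorus g) (c : ℂ) :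
    IsSmoothTorus (c • g) :=
  ContDiff.const_smul c hg

theorem IsSmoothTorus.star {g : UnitAddTorus (Fin k) → ℂ} (hg : IsSmoothTorus g) :
    IsSmoothTorus (star g) :=
  (Complex.conjCLE.contDiff (n := ∞)).comp hg

theorem isSmoothTorus_mFourier (n : Fin k → ℤ) :
    IsSmoothTorus (UnitAddTorus.mFourier n : UnitAddTorus (Fin k) → ℂ) := by
  rw [isSmoothTorus_iff]
  have e : (UnitAddTorus.mFourier n : UnitAddTorus (Fin k) → ℂ) ∘ torusProj =
      fun x : Fin k → ℝ => ∏ i, Complex.exp (2 * Real.pi * Complex.I * n i * (x i : ℂ)) := by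
    ext x
    simp [UnitAddTorus.mFourier, torusProj]
  rw [e]
  refine contDiff_prod fun i _ => ContDiff.cexp (contDiff_const.mul ?_)
  exact (Complex.ofRealCLM.contDiff (n := ∞)).comp (contDiff_apply ℝ ℝ i)

theorem isSmoothTorus_of_mem_span {p : C(UnitAddTorus (Fin k), ℂ)}
    (hp : p ∈ Submodule.span ℂ (Set.range (UnitAddTorus.mFourier (d := Fin k)))) :
    IsSmoothTorus p := by
  induction hp using Submodule.span_induction with
  | zero => exact contDiff_const
  | add x y _ _ hx hy => exact hx.add hy
  | smul c x _ hx => exact hx.const_smul c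
  | mem x hx =>
    obtain ⟨n, rfl⟩ := hx
    exact isSmoothTorus_mFourier n

/-- Trigonometric polynomials are smooth, and they are uniformly dense. -/
theorem exists_isSmoothTorus_norm_sub_lt (f : C(UnitAddTorus (Fin k), ℂ)) {ε : ℝ} (hε : 0 < ε) :
    ∃ p : C(UnitAddTorus (Fin k), ℂ), IsSmoothTorus p ∧ ‖f - p‖ < ε := by
  have h : f ∈ (Submodule.span ℂ
      (Set.range (UnitAddTorus.mFourier (d := Fin k)))).topologicalClosure := by
    rw [UnitAddTorus.span_mFourier_closure_eq_top]; trivial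
  obtain ⟨p, hp, hfp⟩ := Metric.mem_closure_iff.1 h ε hε
  exact ⟨p, isSmoothTorus_of_mem_span hp, by rwa [← dist_eq_norm]⟩

/-- The continuous functions that belong to `C_c^∞(S)`. -/
def ccSmooth (S : Set (UnitAddTorus (Fin k))) : Set C(UnitAddTorus (Fin k), ℂ) :=
  {g | IsSmoothTorus g ∧ tsupport g ⊆ S}

/-- Smooth bump functions on the torus. -/
theorem exists_bump {S K : Set (UnitAddTorus (Fin k))} (hS : IsOpen S) (hK : IsClosed K)
    (hKS : K ⊆ S) : ∃ χ ∈ ccSmooth S, (∀ z ∈ K, χ z = 1) ∧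
      ∀ z, ∃ r ∈ Set.Icc (0 : ℝ) 1, χ z = r := by
  obtain ⟨V, hV, hKV, hVS⟩ := normal_exists_closure_subset hK hS hKS
  obtain ⟨u, hu0, hu1, -⟩ := exists_continuous_zero_one_of_isClosed hV.isClosed_compl hK
    (Set.disjoint_compl_left_iff_subset.2 hKV)
  -- A Urysohn function `u` is smoothed to error `1/4`. Where `u = 0` one has `Re p < 1/4`, and
  -- where `u = 1` one has `Re p > 3/4`; the affine map `2x - 1/2` sends these thresholds to `0` and
  -- `1`, where `smoothTransition` is already constant.
  obtain ⟨p, hp, hup⟩ := exists_isSmoothTorus_norm_sub_lt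
    (⟨fun z => (u z : ℂ), by fun_prop⟩ : C(UnitAddTorus (Fin k), ℂ)) (ε := 1 / 4) (by norm_num)
  have hre : ∀ z, |u z - (p z).re| < 1 / 4 := fun z => by
    refine lt_of_le_of_lt ?_ ((ContinuousMap.norm_coe_le_norm _ z).trans_lt hup)
    simpa using Complex.abs_re_le_norm ((u z : ℂ) - p z)
  let χ : C(UnitAddTorus (Fin k), ℂ) := ⟨fun z => (Real.smoothTransition (2 * (p z).re - 1 / 2) : ℂ),
    Complex.continuous_ofReal.comp (Real.smoothTransition.continuous.comp (by fun_prop))⟩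
  refine ⟨χ, ⟨?_, ?_⟩, ?_, fun z => ⟨_, ⟨Real.smoothTransition.nonneg _,
    Real.smoothTransition.le_one _⟩, rfl⟩⟩
  · refine (Complex.ofRealCLM.contDiff (n := ∞)).comp (Real.smoothTransition.contDiff.comp ?_)
    exact (contDiff_const.mul ((Complex.reCLM.contDiff (n := ∞)).comp hp)).sub contDiff_const
  · refine (closure_mono fun z hz => ?_).trans hVS
    by_contra hzV
    refine hz ?_
    have h0 : u z = 0 := hu0 hzV
    have h1 := abs_lt.1 (hre z)
    change ((Real.smoothTransition (2 * (p z).re - 1 / 2) : ℝ) : ℂ) = 0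
    rw [Real.smoothTransition.zero_of_nonpos (by linarith), Complex.ofReal_zero]
  · intro z hz
    have h0 : u z = 1 := hu1 hz
    have h1 := abs_lt.1 (hre z)
    change ((Real.smoothTransition (2 * (p z).re - 1 / 2) : ℝ) : ℂ) = 1
    rw [Real.smoothTransition.one_of_one_le (by linarith), Complex.ofReal_one]

theorem mul_mem_ccSmooth {S : Set (UnitAddTorus (Fin k))} {f g : C(UnitAddTorus (Fin k), ℂ)}
    (hf : IsSmoothTorus f) (hg : g ∈ ccSmooth S) : f * g ∈ ccSmooth S :=
  ⟨hf.mul hg.1, (tsupport_mul_subset_right (f := f) (g := g)).trans hg.2⟩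

theorem eq_zero_of_mem_ccSmooth {S : Set (UnitAddTorus (Fin k))} {g : C(UnitAddTorus (Fin k), ℂ)}
    (hg : g ∈ ccSmooth S) {z : UnitAddTorus (Fin k)} (hz : z ∉ S) : g z = 0 :=
  image_eq_zero_of_notMem_tsupport fun h => hz (hg.2 h)

/-- Multiply a smooth approximant `p` of `f` by a bump function `χ` that is `1` on the closed set
`{|f| ≥ ε/3}`, which lies in `S`. Then `f - pχ = f(1 - χ) + (f - p)χ`, and each term is at most
`ε/3`. -/
theorem mem_closure_ccSmooth {S : Set (UnitAddTorus (Fin k))} (hS : IsOpen S)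
    {f : C(UnitAddTorus (Fin k), ℂ)} (hf : ∀ z ∉ S, f z = 0) : f ∈ closure (ccSmooth S) := by
  rw [Metric.mem_closure_iff]
  intro ε hε
  obtain ⟨p, hp, hfp⟩ := exists_isSmoothTorus_norm_sub_lt f (ε := ε / 3) (by positivity)
  obtain ⟨χ, hχ, hχ1, hχr⟩ := exists_bump (K := {z | ε / 3 ≤ ‖f z‖}) hS
    (isClosed_le continuous_const (by fun_prop)) fun z hz => by
      by_contra h
      have : ε / 3 ≤ ‖f z‖ := hz
      rw [hf z h, norm_zero] at this
      linarith
  refine ⟨p * χ, mul_mem_ccSmooth hp hχ, ?_⟩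
  rw [dist_eq_norm]
  refine lt_of_le_of_lt ((ContinuousMap.norm_le _ (by positivity : 0 ≤ ε / 3 + ε / 3)).2 fun z => ?_)
    (by linarith : ε / 3 + ε / 3 < ε)
  obtain ⟨r, hr, hrz⟩ := hχr z
  have e : (f - p * χ) z = f z * (1 - χ z) + (f - p) z * χ z := by
    simp only [ContinuousMap.sub_apply, ContinuousMap.mul_apply]; ring
  rw [e]
  refine (norm_add_le _ _).trans (add_le_add ?_ ?_)
  · by_cases hz : ε / 3 ≤ ‖f z‖
    · rw [hχ1 z hz, sub_self, mul_zero, norm_zero]; positivity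
    · rw [norm_mul, hrz, ← Complex.ofReal_one, ← Complex.ofReal_sub, Complex.norm_real,
        Real.norm_of_nonneg (by linarith [hr.2])]
      nlinarith [hr.1, norm_nonneg (f z)]
  · rw [norm_mul, hrz, Complex.norm_real, Real.norm_of_nonneg hr.1]
    have := (ContinuousMap.norm_coe_le_norm (f - p) z).trans hfp.le
    nlinarith [hr.2, norm_nonneg ((f - p) z)]

/-- A bump function equal to `1` on the support of `f` is a local unit. Hence the products `g · conj
h` already exhaust `C_c^∞(S)`. -/
theorem exists_eq_mul_star_of_mem_ccSmooth {S : Set (UnitAddTorus (Fin k))} (hS : IsOpen S)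
    {f : C(UnitAddTorus (Fin k), ℂ)} (hf : f ∈ ccSmooth S) :
    ∃ χ ∈ ccSmooth S, f = f * star χ := by
  obtain ⟨χ, hχ, hχ1, -⟩ := exists_bump hS (isClosed_tsupport f) hf.2
  refine ⟨χ, hχ, ?_⟩
  ext z
  by_cases hz : z ∈ tsupport f
  · simp [hχ1 z hz]
  · simp [image_eq_zero_of_notMem_tsupport hz]

theorem mem_fourierPreimage_iff {S : Set (UnitAddTorus (Fin k))} {ξ : EllTwo (IntPow k)} :
    ξ ∈ fourierPreimage S ↔ ∃ g ∈ ccSmooth S, fourierL2 k ξ =ᵐ[torusHaar k] g :=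
  ⟨fun ⟨g, h1, _, h3, h4⟩ => ⟨⟨g, h1.continuous⟩, ⟨h1, h3⟩, h4⟩,
    fun ⟨g, h, h'⟩ => ⟨g, h.1, .of_compactSpace g, h.2, h'⟩⟩

/-! ## Fourier coefficients of smooth functions -/

/-- The `j`-th partial derivative on the torus. -/
def torusDeriv (j : Fin k) (g : UnitAddTorus (Fin k) → ℂ) (z : UnitAddTorus (Fin k)) : ℂ :=
  deriv (fun h : ℝ => g (z + torusProj (Pi.single j h))) 0

theorem torusProj_add (x y : Fin k → ℝ) : torusProj (x + y) = torusProj x + torusProj y := by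
  ext i; simp [torusProj]

theorem torusProj_zero : torusProj (0 : Fin k → ℝ) = 0 := by
  ext i; simp [torusProj]

/-- Since `torusDeriv` is defined by translation on the torus itself, periodicity of the partial
derivative of the lift comes for free. -/
theorem torusDeriv_torusProj {g : UnitAddTorus (Fin k) → ℂ} (hg : IsSmoothTorus g) (j : Fin k)
    (x : Fin k → ℝ) :
    torusDeriv j g (torusProj x) = fderiv ℝ (g ∘ torusProj) x (Pi.single j 1) := by
  have h1 : HasFDerivAt (g ∘ torusProj) (fderiv ℝ (g ∘ torusProj) x)
      (x + Pi.single j (0 : ℝ)) := by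
    rw [Pi.single_zero, add_zero]
    exact ((ContDiff.differentiable hg (by simp)) x).hasFDerivAt
  have h2 : HasDerivAt (fun h : ℝ => x + Pi.single j h) (Pi.single j 1) 0 :=
    (hasDerivAt_single j 0).const_add x
  have h3 := (h1.comp_hasDerivAt 0 h2).deriv
  rw [← h3]
  unfold torusDeriv
  simp only [Function.comp_def, torusProj_add]

theorem IsSmoothTorus.torusDeriv {g : UnitAddTorus (Fin k) → ℂ} (hg : IsSmoothTorus g)
    (j : Fin k) : IsSmoothTorus (torusDeriv j g) := by
  rw [isSmoothTorus_iff]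
  have : RieffelProper.torusDeriv j g ∘ torusProj =
      fun x => fderiv ℝ (g ∘ torusProj) x (Pi.single j 1) :=
    funext fun x => torusDeriv_torusProj hg j x
  rw [this]
  exact (ContDiff.fderiv_right (m := ∞) hg (by simp)).clm_apply contDiff_const

theorem hasDerivAt_torus {g : UnitAddTorus (Fin k) → ℂ} (hg : IsSmoothTorus g) (j : Fin k)
    (z : UnitAddTorus (Fin k)) (h : ℝ) :
    HasDerivAt (fun h : ℝ => g (z + torusProj (Pi.single j h)))
      (torusDeriv j g (z + torusProj (Pi.single j h))) h := by
  obtain ⟨x, rfl⟩ := isOpenQuotientMap_torusProj.surjective z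
  rw [← torusProj_add, torusDeriv_torusProj hg]
  have h1 : HasFDerivAt (g ∘ torusProj) (fderiv ℝ (g ∘ torusProj) (x + Pi.single j h))
      (x + Pi.single j h) := ((ContDiff.differentiable hg (by simp)) _).hasFDerivAt
  have h3 := h1.comp_hasDerivAt h ((hasDerivAt_single j h).const_add x)
  simpa [Function.comp_def, torusProj_add] using h3

theorem mFourier_add_apply (n : Fin k → ℤ) (z w : UnitAddTorus (Fin k)) :
    UnitAddTorus.mFourier n (z + w) = UnitAddTorus.mFourier n z * UnitAddTorus.mFourier n w := by
  simp [UnitAddTorus.mFourier, fourier_apply, AddCircle.toCircle_add, Finset.prod_mul_distrib]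

theorem norm_mFourier_mul_le (n : Fin k → ℤ) (z : UnitAddTorus (Fin k)) (w : ℂ) :
    ‖UnitAddTorus.mFourier n z * w‖ ≤ ‖w‖ := by
  rw [norm_mul]
  refine mul_le_of_le_one_left (norm_nonneg w) ?_
  exact ((UnitAddTorus.mFourier n).norm_coe_le_norm z).trans_eq UnitAddTorus.mFourier_norm

theorem mFourier_torusProj_single (n : Fin k → ℤ) (j : Fin k) (h : ℝ) :
    UnitAddTorus.mFourier n (torusProj (Pi.single j h)) =
      Complex.exp (2 * Real.pi * Complex.I * n j * h) := by
  rw [UnitAddTorus.mFourier, ContinuousMap.coe_mk, Finset.prod_eq_single j]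
  · simp [torusProj]
  · intro i _ hi
    simp [torusProj, hi]
  · simp

/-- Differentiation multiplies Fourier coefficients by `2πi n_j`. -/
theorem integral_mFourier_mul_torusDeriv {g : UnitAddTorus (Fin k) → ℂ} (hg : IsSmoothTorus g)
    (j : Fin k) (n : Fin k → ℤ) :
    ∫ z, UnitAddTorus.mFourier (-n) z * torusDeriv j g z ∂torusHaar k =
      2 * Real.pi * Complex.I * n j * ∫ z, UnitAddTorus.mFourier (-n) z * g z ∂torusHaar k := by
  set c := ∫ z, UnitAddTorus.mFourier (-n) z * g z ∂torusHaar k with hc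
  have hD := (hg.torusDeriv j).continuous
  have hint : ∀ f : UnitAddTorus (Fin k) → ℂ, Continuous f → Integrable f (torusHaar k) :=
    fun f hf => hf.integrable_of_hasCompactSupport (.of_compactSpace f)
  obtain ⟨C, hC⟩ := (isCompact_range hD).isBounded.exists_norm_le
  have hC' : ∀ z, ‖torusDeriv j g z‖ ≤ C := fun z => hC _ ⟨z, rfl⟩
  -- Translation invariance of Haar measure moves the shift from `g` to the character, where it
  -- becomes a scalar. Both sides are then differentiated at `h = 0`.
  have e : ∀ h : ℝ, ∫ z, UnitAddTorus.mFourier (-n) z * g (z + torusProj (Pi.single j h))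
      ∂torusHaar k = Complex.exp (2 * Real.pi * Complex.I * n j * h) * c := by
    intro h
    rw [hc, ← integral_const_mul,
      ← integral_add_right_eq_self (fun z => Complex.exp (2 * Real.pi * Complex.I * n j * h) *
        (UnitAddTorus.mFourier (-n) z * g z)) (torusProj (Pi.single j h))]
    congr 1
    ext z
    have h1 : Complex.exp (2 * Real.pi * Complex.I * n j * h) *
        UnitAddTorus.mFourier (-n) (torusProj (Pi.single j h)) = 1 := by
      rw [mFourier_torusProj_single, ← Complex.exp_add]
      simp
    rw [mFourier_add_apply]
    linear_combination (-(UnitAddTorus.mFourier (-n) z * g (z + torusProj (Pi.single j h)))) * h1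
  -- Differentiation under the integral; the derivative is continuous on a compact space, so a
  -- constant dominates.
  have hL := hasDerivAt_integral_of_dominated_loc_of_deriv_le (μ := torusHaar k)
    (F := fun (h : ℝ) z => UnitAddTorus.mFourier (-n) z * g (z + torusProj (Pi.single j h)))
    (F' := fun (h : ℝ) z =>
      UnitAddTorus.mFourier (-n) z * torusDeriv j g (z + torusProj (Pi.single j h)))
    (x₀ := 0) (s := Set.univ) (bound := fun _ => C) univ_mem
    (.of_forall fun h => ((ContinuousMap.continuous _).mul
      (hg.continuous.comp (continuous_add_const _))).aestronglyMeasurable)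
    (hint _ ((ContinuousMap.continuous _).mul (hg.continuous.comp (continuous_add_const _))))
    ((ContinuousMap.continuous _).mul (hD.comp (continuous_add_const _))).aestronglyMeasurable
    (.of_forall fun z h _ => (norm_mFourier_mul_le _ z _).trans (hC' _))
    (integrable_const _)
    (.of_forall fun z h _ => (hasDerivAt_torus hg j z h).const_mul _)
  have hL' := hL.2
  simp only [e, Pi.single_zero, torusProj_zero, add_zero] at hL'
  have hR : HasDerivAt (fun h : ℝ => Complex.exp (2 * Real.pi * Complex.I * n j * h) * c)
      (2 * Real.pi * Complex.I * n j * c) 0 := by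
    have h1 : HasDerivAt (fun h : ℝ => 2 * Real.pi * Complex.I * n j * (h : ℂ))
        (2 * Real.pi * Complex.I * n j) 0 := by
      simpa using ((hasDerivAt_id (0 : ℝ)).ofReal_comp).const_mul (2 * Real.pi * Complex.I * n j)
    simpa using h1.cexp.mul_const c
  exact hL'.unique hR

/-- The operator `1 - ∂_j²` multiplies the `n`-th Fourier coefficient by `1 + (2π n_j)²` and
preserves smoothness. It is applied once for each `j ∈ s`, after which the trivial sup-norm bound
remains. -/
theorem exists_prod_mul_norm_integral_le (s : Finset (Fin k)) :
    ∀ {g : UnitAddTorus (Fin k) → ℂ}, IsSmoothTorus g → ∃ C : ℝ, ∀ n : Fin k → ℤ,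
      (∏ j ∈ s, (1 + (2 * Real.pi * n j) ^ 2)) *
        ‖∫ z, UnitAddTorus.mFourier (-n) z * g z ∂torusHaar k‖ ≤ C := by
  have hint : ∀ f : UnitAddTorus (Fin k) → ℂ, Continuous f → Integrable f (torusHaar k) :=
    fun f hf => hf.integrable_of_hasCompactSupport (.of_compactSpace f)
  induction s using Finset.induction_on with
  | empty =>
    intro g hg
    obtain ⟨C, hC⟩ := (isCompact_range hg.continuous).isBounded.exists_norm_le
    refine ⟨C, fun n => ?_⟩
    rw [Finset.prod_empty, one_mul]
    refine (norm_integral_le_of_norm_le_const (C := C) (.of_forall fun z => ?_)).trans_eq ?_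
    · exact (norm_mFourier_mul_le _ z _).trans (hC _ ⟨z, rfl⟩)
    · simp
  | insert j s hj ih =>
    intro g hg
    have hg2 := (hg.torusDeriv j).torusDeriv j
    obtain ⟨C, hC⟩ := ih (hg.sub hg2)
    refine ⟨C, fun n => (le_of_eq ?_).trans (hC n)⟩
    have e : ∫ z, UnitAddTorus.mFourier (-n) z * (g - torusDeriv j (torusDeriv j g)) z ∂torusHaar k =
        (1 + (2 * Real.pi * n j) ^ 2 : ℝ) *
          ∫ z, UnitAddTorus.mFourier (-n) z * g z ∂torusHaar k := by
      simp only [Pi.sub_apply, mul_sub]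
      have h1 : Integrable (fun z => UnitAddTorus.mFourier (-n) z * g z) (torusHaar k) :=
        hint _ ((ContinuousMap.continuous _).mul hg.continuous)
      have h2 : Integrable (fun z => UnitAddTorus.mFourier (-n) z *
          torusDeriv j (torusDeriv j g) z) (torusHaar k) :=
        hint _ ((ContinuousMap.continuous _).mul hg2.continuous)
      rw [integral_sub h1 h2, integral_mFourier_mul_torusDeriv (hg.torusDeriv j), integral_mFourier_mul_torusDeriv hg]
      push_cast
      linear_combination (-(2 * Real.pi * n j) ^ 2 *
        ∫ z, UnitAddTorus.mFourier (-n) z * g z ∂torusHaar k) * Complex.I_sq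
    rw [e, norm_mul, Complex.norm_real, Real.norm_of_nonneg (by positivity),
      Finset.prod_insert hj]
    ring

theorem summable_one_div_one_add_sq :
    Summable fun n : ℤ => (1 + (2 * Real.pi * n) ^ 2)⁻¹ := by
  have h := (Real.summable_one_div_int_pow (p := 2)).2 (by norm_num)
  -- At `n = 0` the comparison term `1 / n²` has the default value `0`, so the missing `1` is added
  -- separately.
  have h0 : Summable fun n : ℤ => if n = 0 then (1 : ℝ) else 0 := (hasSum_ite_eq 0 1).summable
  refine .of_nonneg_of_le (fun n => by positivity) (fun n => ?_) (h.add h0)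
  rcases eq_or_ne n 0 with rfl | hn
  · simp
  · rw [if_neg hn, add_zero, one_div]
    have hn' : 0 < (n : ℝ) ^ 2 := by positivity
    gcongr
    have : (1 : ℝ) ≤ (2 * Real.pi) ^ 2 := by nlinarith [Real.pi_gt_three]
    rw [mul_pow]
    nlinarith

/-- A finite set of multi-indices lies in a box, and the sum of the products over a box is the
product of one-dimensional sums. -/
theorem summable_prod_of_nonneg {ι : Type*} [Fintype ι] {a : ℤ → ℝ} (ha : ∀ n, 0 ≤ a n)
    (h : Summable a) : Summable fun n : ι → ℤ => ∏ j, a (n j) := by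
  classical
  refine summable_of_sum_le (c := ∏ _j : ι, ∑' m, a m)
    (fun n => Finset.prod_nonneg fun j _ => ha _) fun s => ?_
  calc ∑ n ∈ s, ∏ j, a (n j)
      ≤ ∑ n ∈ Fintype.piFinset fun j => s.image fun n => n j, ∏ j, a (n j) := by
        refine Finset.sum_le_sum_of_subset_of_nonneg (fun n hn => ?_)
          fun n _ _ => Finset.prod_nonneg fun j _ => ha _
        exact Fintype.mem_piFinset.2 fun j => Finset.mem_image_of_mem _ hn
    _ = ∏ j, ∑ m ∈ s.image fun n => n j, a m := (Finset.prod_univ_sum _ _).symm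
    _ ≤ _ := Finset.prod_le_prod (fun j _ => Finset.sum_nonneg fun m _ => ha m)
        fun j _ => h.sum_le_tsum _ fun m _ => ha m

/-- The Fourier series of a smooth function converges absolutely. -/
theorem IsSmoothTorus.summable {g : UnitAddTorus (Fin k) → ℂ} (hg : IsSmoothTorus g) :
    Summable fun n : Fin k → ℤ =>
      ‖∫ z, UnitAddTorus.mFourier (-n) z * g z ∂torusHaar k‖ := by
  obtain ⟨C, hC⟩ := exists_prod_mul_norm_integral_le Finset.univ hg
  refine .of_nonneg_of_le (fun n => norm_nonneg _) (fun n => ?_)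
    ((summable_prod_of_nonneg (fun n => by positivity) summable_one_div_one_add_sq).mul_left C)
  rw [Finset.prod_inv_distrib, ← div_eq_mul_inv, le_div_iff₀' (Finset.prod_pos fun j _ => by positivity)]
  exact hC n

end RieffelProper

end

noncomputable section

namespace RieffelProper

open Filter Topology

variable {k : ℕ} {S : Set (UnitAddTorus (Fin k))}

/-! ## `C₀(S)` as an ideal of `C(𝕋^k)` -/

theorem extendZero_apply_coe (f : C₀(S, ℂ)) (z : S) : extendZero f z = f z :=
  Subtype.val_injective.extend_apply _ _ _

theorem extendZero_apply_of_notMem (f : C₀(S, ℂ)) {z : UnitAddTorus (Fin k)} (hz : z ∉ S) :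
    extendZero f z = 0 :=
  Function.extend_apply' _ _ _ (by rintro ⟨x, rfl⟩; exact hz x.2)

theorem continuous_extendZero (hS : IsOpen S) (f : C₀(S, ℂ)) : Continuous (extendZero f) := by
  rw [continuous_iff_continuousAt]
  intro z
  by_cases hz : z ∈ S
  · refine (hS.isOpenEmbedding_subtypeVal.continuousAt_iff (x := ⟨z, hz⟩)).1 ?_
    have : extendZero f ∘ Subtype.val = f := funext (extendZero_apply_coe f)
    rw [this]
    exact (map_continuous f).continuousAt
  -- Outside `S` the value is `0`: a compact subset of `S` off which `|f| < ε` is closed in the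
  -- torus and misses `z`, so its complement is a neighbourhood.
  · rw [ContinuousAt, extendZero_apply_of_notMem f hz, Metric.tendsto_nhds]
    intro ε hε
    have h1 := Metric.tendsto_nhds.1 (zero_at_infty f) ε hε
    obtain ⟨K, hK, hKf⟩ := mem_cocompact.1 h1
    have hK' : IsClosed (Subtype.val '' K : Set (UnitAddTorus (Fin k))) :=
      (hK.image continuous_subtype_val).isClosed
    filter_upwards [hK'.isOpen_compl.mem_nhds (by rintro ⟨x, _, rfl⟩; exact hz x.2)] with w hw
    by_cases hwS : w ∈ S
    · have : dist (f ⟨w, hwS⟩) 0 < ε :=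
        hKf (show (⟨w, hwS⟩ : S) ∈ Kᶜ from fun h => hw ⟨_, h, rfl⟩)
      rwa [← extendZero_apply_coe f ⟨w, hwS⟩] at this
    · rwa [extendZero_apply_of_notMem f hwS, dist_self]

theorem extend_ext {F G : UnitAddTorus (Fin k) → ℂ} (h : ∀ z : S, F z = G z)
    (hF : ∀ z ∉ S, F z = 0) (hG : ∀ z ∉ S, G z = 0) (z : UnitAddTorus (Fin k)) : F z = G z := by
  by_cases hz : z ∈ S
  · exact h ⟨z, hz⟩
  · rw [hF z hz, hG z hz]

/-- Extension by zero as a homomorphism `C₀(S) → C(𝕋^k)`. -/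
def extendZeroHom (hS : IsOpen S) : C₀(S, ℂ) →⋆ₙₐ[ℂ] C(UnitAddTorus (Fin k), ℂ) where
  toFun f := ⟨extendZero f, continuous_extendZero hS f⟩
  map_smul' c f := by
    ext z
    refine extend_ext (S := S) (fun z => ?_) (fun z hz => ?_) (fun z hz => ?_) z <;>
      simp [extendZero_apply_coe, extendZero_apply_of_notMem, *]
  map_zero' := by
    ext z
    refine extend_ext (S := S) (fun z => ?_) (fun z hz => ?_) (fun z hz => ?_) z <;>
      simp [extendZero_apply_coe, extendZero_apply_of_notMem, *]
  map_add' f g := by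
    ext z
    refine extend_ext (S := S) (fun z => ?_) (fun z hz => ?_) (fun z hz => ?_) z <;>
      simp [extendZero_apply_coe, extendZero_apply_of_notMem, *]
  map_mul' f g := by
    ext z
    refine extend_ext (S := S) (fun z => ?_) (fun z hz => ?_) (fun z hz => ?_) z <;>
      simp [extendZero_apply_coe, extendZero_apply_of_notMem, *]
  map_star' f := by
    ext z
    refine extend_ext (S := S) (fun z => ?_) (fun z hz => ?_) (fun z hz => ?_) z <;>
      simp [extendZero_apply_coe, extendZero_apply_of_notMem, *]

@[simp] theorem coe_extendZeroHom (hS : IsOpen S) (f : C₀(S, ℂ)) :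
    ⇑(extendZeroHom hS f) = extendZero f := rfl

theorem extendZeroHom_injective (hS : IsOpen S) : Function.Injective (extendZeroHom hS) := by
  intro f g h
  ext z
  rw [← extendZero_apply_coe, ← extendZero_apply_coe, ← coe_extendZeroHom hS, h, coe_extendZeroHom]

/-- For `ε > 0` the set `{|F| ≥ ε}` is closed in the compact torus and contained in `S`, hence
compact in `S`; so the restriction of `F` vanishes at infinity. -/
theorem exists_extendZeroHom_eq (hS : IsOpen S) {F : C(UnitAddTorus (Fin k), ℂ)}
    (hF : ∀ z ∉ S, F z = 0) : ∃ f, extendZeroHom hS f = F := by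
  let f : C₀(S, ℂ) :=
    { toFun := fun z => F z
      zero_at_infty' := by
        rw [Metric.tendsto_nhds]
        intro ε hε
        refine mem_cocompact.2 ⟨{z | ε ≤ ‖F z‖}, ?_, fun z hz => ?_⟩
        · rw [Topology.IsInducing.subtypeVal.isCompact_iff]
          have e : Subtype.val '' {z : S | ε ≤ ‖F z‖} = {z | ε ≤ ‖F z‖} := by
            ext z
            refine ⟨by rintro ⟨x, hx, rfl⟩; exact hx, fun hz => ?_⟩
            have hzS : z ∈ S := by
              by_contra h
              have : ε ≤ ‖F z‖ := hz
              rw [hF z h, norm_zero] at this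
              linarith
            exact ⟨⟨z, hzS⟩, hz, rfl⟩
          rw [e]
          exact (isClosed_le continuous_const (by fun_prop)).isCompact
        · rw [Set.mem_ofPred_eq, dist_zero_right]
          exact not_le.1 hz }
  refine ⟨f, ContinuousMap.ext ?_⟩
  exact extend_ext (S := S) (extendZero_apply_coe f) (fun z => extendZero_apply_of_notMem f) hF

theorem mem_range_extendZeroHom (hS : IsOpen S) {F : C(UnitAddTorus (Fin k), ℂ)} :
    F ∈ Set.range (extendZeroHom hS) ↔ ∀ z ∉ S, F z = 0 :=
  ⟨by rintro ⟨f, rfl⟩; exact fun z => extendZero_apply_of_notMem f, exists_extendZeroHom_eq hS⟩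

/-! ### Subalgebras and subspaces whose closure is a copy of C₀(S). -/

section Closure

variable {B : Type*} [NonUnitalCStarAlgebra B] (φ : C(UnitAddTorus (Fin k), ℂ) →⋆ₙₐ[ℂ] B)

theorem range_comp_extendZeroHom_subset_closure (hS : IsOpen S) {s : Set B}
    (hs : φ '' ccSmooth S ⊆ s) : Set.range (φ.comp (extendZeroHom hS)) ⊆ closure s := by
  rintro _ ⟨f, rfl⟩
  have hφ : Continuous φ :=
    AddMonoidHomClass.continuous_of_bound φ 1 fun a => by
      rw [one_mul]; exact NonUnitalStarAlgHom.norm_apply_le φ a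
  have hf := mem_closure_ccSmooth hS ((mem_range_extendZeroHom hS).1 ⟨f, rfl⟩)
  exact closure_mono hs (image_closure_subset_closure_image hφ ⟨_, hf, rfl⟩)

variable {φ}

theorem comp_extendZeroHom_injective (hS : IsOpen S) (hφ : Function.Injective φ) :
    Function.Injective (φ.comp (extendZeroHom hS)) :=
  hφ.comp (extendZeroHom_injective hS)

/-- An injective `*`-homomorphism of C*-algebras is isometric, so its range is complete. -/
theorem isClosed_range_comp_extendZeroHom (hS : IsOpen S) (hφ : Function.Injective φ) :
    IsClosed (Set.range (φ.comp (extendZeroHom hS))) :=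
  (AddMonoidHomClass.isometry_of_norm (φ.comp (extendZeroHom hS))
    (NonUnitalStarAlgHom.norm_map _
      (comp_extendZeroHom_injective hS hφ))).isClosedEmbedding.isClosed_range

theorem image_ccSmooth_subset_range (hS : IsOpen S) :
    φ '' ccSmooth S ⊆ Set.range (φ.comp (extendZeroHom hS)) := by
  rintro _ ⟨g, hg, rfl⟩
  obtain ⟨f, hf⟩ := exists_extendZeroHom_eq hS fun z => eq_zero_of_mem_ccSmooth hg
  exact ⟨f, congrArg φ hf⟩

/-- A C*-subalgebra generated by sufficiently many functions in `C_c^∞(S)` is `C₀(S)`. -/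
theorem coe_closure_adjoin_eq_range (hS : IsOpen S) (hφ : Function.Injective φ) {s : Set B}
    (hs : s ⊆ φ '' ccSmooth S) (hs' : ∀ g ∈ ccSmooth S, ∀ h ∈ ccSmooth S, φ (g * star h) ∈ s) :
    ((NonUnitalStarAlgebra.adjoin ℂ s).topologicalClosure : Set B) =
      Set.range (φ.comp (extendZeroHom hS)) := by
  refine Set.Subset.antisymm ?_ ?_
  · refine closure_minimal ?_ (isClosed_range_comp_extendZeroHom hS hφ)
    have h := NonUnitalStarAlgebra.adjoin_le (R := ℂ)
      (S := NonUnitalStarAlgHom.range (φ.comp (extendZeroHom hS))) (s := s)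
      (by rw [NonUnitalStarAlgHom.coe_range]; exact hs.trans (image_ccSmooth_subset_range hS))
    intro x hx
    exact h hx
  · refine range_comp_extendZeroHom_subset_closure φ hS ?_
    rintro _ ⟨g, hg, rfl⟩
    obtain ⟨χ, hχ, e⟩ := exists_eq_mul_star_of_mem_ccSmooth hS hg
    rw [e]
    exact NonUnitalStarAlgebra.subset_adjoin ℂ s (hs' g hg χ hχ)

/-- The linear counterpart of the previous result, needed for `F(R_S)`, where only a closed span is
taken. -/
theorem coe_closure_span_eq_range (hS : IsOpen S) (hφ : Function.Injective φ) {s : Set B}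
    (hs : s = φ '' ccSmooth S) :
    ((Submodule.span ℂ s).topologicalClosure : Set B) =
      Set.range (φ.comp (extendZeroHom hS)) := by
  subst hs
  refine Set.Subset.antisymm ?_ ?_
  · refine closure_minimal ?_ (isClosed_range_comp_extendZeroHom hS hφ)
    have h : Submodule.span ℂ (φ '' ccSmooth S) ≤
        LinearMap.range ((φ.comp (extendZeroHom hS) : C₀(S, ℂ) →⋆ₙₐ[ℂ] B) : C₀(S, ℂ) →ₗ[ℂ] B) :=
      Submodule.span_le.2 (image_ccSmooth_subset_range hS)
    intro x hx
    exact h hx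
  · exact range_comp_extendZeroHom_subset_closure φ hS Submodule.subset_span

end Closure

/-- An injective homomorphism is an isomorphism onto any subalgebra equal to its range. -/
def starAlgEquivOfRange {A B : Type*} [NonUnitalCStarAlgebra A] [NonUnitalCStarAlgebra B]
    (ψ : A →⋆ₙₐ[ℂ] B) (hψ : Function.Injective ψ) (D : NonUnitalStarSubalgebra ℂ B)
    (hD : (D : Set B) = Set.range ψ) : A ≃⋆ₐ[ℂ] D :=
  StarAlgEquiv.ofBijective
    (NonUnitalStarAlgHom.codRestrict ψ D fun x => by
      rw [← SetLike.mem_coe, hD]; exact ⟨x, rfl⟩) <| by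
    refine ⟨fun x y h => hψ (congrArg Subtype.val h), fun y => ?_⟩
    have h : (y : B) ∈ Set.range ψ := hD ▸ y.2
    obtain ⟨x, hx⟩ := h
    exact ⟨x, Subtype.ext hx⟩

/-- An injective homomorphism is an isometric isomorphism onto any subspace equal to its range. -/
def linearIsometryEquivOfRange {A B : Type*} [NonUnitalCStarAlgebra A] [NonUnitalCStarAlgebra B]
    (ψ : A →⋆ₙₐ[ℂ] B) (hψ : Function.Injective ψ) (D : Submodule ℂ B)
    (hD : (D : Set B) = Set.range ψ) : A ≃ₗᵢ[ℂ] D where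
  toLinearEquiv := .ofBijective
    (LinearMap.codRestrict D (ψ : A →ₗ[ℂ] B) fun x => by
      rw [← SetLike.mem_coe, hD]; exact ⟨x, rfl⟩) <| by
    refine ⟨fun x y h => hψ (congrArg Subtype.val h), fun y => ?_⟩
    have h : (y : B) ∈ Set.range ψ := hD ▸ y.2
    obtain ⟨x, hx⟩ := h
    exact ⟨x, Subtype.ext hx⟩
  norm_map' x := NonUnitalStarAlgHom.norm_map ψ hψ x

end RieffelProper

end

noncomputable section

namespace RieffelProper

open ContinuousLinearMap Filter Topology

/-! ## Relatively `L¹` subspaces and strict integrals -/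

section Algebra

variable {G A : Type*} [NonUnitalCStarAlgebra A]

theorem IsStrictIntegral.unique {f : G → A} {m m' : 𝓜(ℂ, A)} (h : IsStrictIntegral f m)
    (h' : IsStrictIntegral f m') : m = m' :=
  DoubleCentralizer.ext _ _ _ _ (Prod.ext
    (ContinuousLinearMap.ext fun a => (h a).1.unique (h' a).1)
    (ContinuousLinearMap.ext fun a => (h a).2.unique (h' a).2))

theorem isStrictIntegral_zero : IsStrictIntegral (fun _ : G => (0 : A)) 0 := fun a => by
  simp [hasSum_zero]

theorem IsStrictIntegral.add {f f' : G → A} {m m' : 𝓜(ℂ, A)} (h : IsStrictIntegral f m)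
    (h' : IsStrictIntegral f' m') : IsStrictIntegral (fun t => f t + f' t) (m + m') := fun a => by
  simp only [add_mul, mul_add]
  exact ⟨(h a).1.add (h' a).1, (h a).2.add (h' a).2⟩

theorem IsStrictIntegral.const_smul {f : G → A} {m : 𝓜(ℂ, A)} (h : IsStrictIntegral f m) (c : ℂ) :
    IsStrictIntegral (fun t => c • f t) (c • m) := fun a => by
  simp only [smul_mul_assoc, mul_smul_comm]
  exact ⟨(h a).1.const_smul c, (h a).2.const_smul c⟩

variable [Group G] {α : G →* (A ≃⋆ₐ[ℂ] A)}

theorem IsRelativelyL1Alg.span {s : Set A} (h : IsRelativelyL1Alg α s) :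
    IsRelativelyL1Alg α (Submodule.span ℂ s : Set A) := by
  intro ξ hξ η hη
  induction hη using Submodule.span_induction with
  | zero => simp
  | add x y _ _ hx hy =>
    refine (hx.add hy).of_nonneg_of_le (fun t => norm_nonneg _) fun t => ?_
    rw [map_add, mul_add]
    exact norm_add_le _ _
  | smul c x _ hx =>
    refine (hx.mul_left ‖c‖).congr fun t => ?_
    rw [map_smul, mul_smul_comm, norm_smul]
  | mem x hx =>
    induction hξ using Submodule.span_induction with
    | zero => simp
    | add y z _ _ hy hz =>
      refine (hy.add hz).of_nonneg_of_le (fun t => norm_nonneg _) fun t => ?_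
      rw [star_add, add_mul]
      exact norm_add_le _ _
    | smul c y _ hy =>
      refine (hy.mul_left ‖c‖).congr fun t => ?_
      rw [star_smul, smul_mul_assoc, norm_smul, norm_star]
    | mem y hy => exact h y hy x hx

/-- The adjoint of `α_t(a) ζ` is `ζ* α_t(a*)`, which has the form required in the definition. -/
theorem IsRelativelyL1Alg.summable_mul {R : Set A} (h : IsRelativelyL1Alg α R) {a ζ : A}
    (ha : star a ∈ R) (hζ : ζ ∈ R) : Summable fun t => ‖α t a * ζ‖ := by
  refine (h ζ hζ _ ha).congr fun t => ?_
  rw [← norm_star, star_mul, star_star, map_star, star_star]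

/-- Strict integrals depend sesquilinearly on `(a, b)`. The subspace `M` carries along what is known
about the integrals of generators, here that their symbols lie in `C_c^∞(S)`. -/
theorem exists_isStrictIntegral_of_mem_span {s : Set A} {M : Submodule ℂ 𝓜(ℂ, A)}
    (h : ∀ a ∈ s, ∀ b ∈ s, ∃ m ∈ M, IsStrictIntegral (fun t => α t (a * star b)) m) {a b : A}
    (ha : a ∈ Submodule.span ℂ s) (hb : b ∈ Submodule.span ℂ s) :
    ∃ m ∈ M, IsStrictIntegral (fun t => α t (a * star b)) m := by
  induction ha using Submodule.span_induction with
  | zero =>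
    refine ⟨0, zero_mem M, ?_⟩
    simp only [zero_mul, map_zero]
    exact isStrictIntegral_zero
  | add x y _ _ hx hy =>
    obtain ⟨f, hf, hf'⟩ := hx
    obtain ⟨g, hg, hg'⟩ := hy
    refine ⟨f + g, add_mem hf hg, ?_⟩
    simp only [add_mul, map_add]
    exact hf'.add hg'
  | smul c x _ hx =>
    obtain ⟨f, hf, hf'⟩ := hx
    refine ⟨c • f, M.smul_mem c hf, ?_⟩
    simp only [smul_mul_assoc, map_smul]
    exact hf'.const_smul c
  | mem x hx =>
    induction hb using Submodule.span_induction with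
    | zero =>
      refine ⟨0, zero_mem M, ?_⟩
      simp only [star_zero, mul_zero, map_zero]
      exact isStrictIntegral_zero
    | add x y _ _ hx hy =>
      obtain ⟨f, hf, hf'⟩ := hx
      obtain ⟨g, hg, hg'⟩ := hy
      refine ⟨f + g, add_mem hf hg, ?_⟩
      simp only [star_add, mul_add, map_add]
      exact hf'.add hg'
    | smul c x _ hx =>
      obtain ⟨f, hf, hf'⟩ := hx
      refine ⟨star c • f, M.smul_mem _ hf, ?_⟩
      simp only [star_smul, mul_smul_comm, map_smul]
      exact hf'.const_smul (star c)
    | mem y hy => exact h x hx y hy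

end Algebra

/-! ### Rank-one operators under Ad u, and the *-algebra spanned by |R⟩⟨R|. -/

section Representation

variable {G H : Type*} [Group G] [NormedAddCommGroup H] [InnerProductSpace ℂ H] [CompleteSpace H]
  {u : G →* unitary (H →L[ℂ] H)}

/-- The product is `⟨ξ, u_t ξ'⟩ |η⟩⟨u_t η'|`, whose norm depends on `t` only through the scalar;
hence no condition on the second entries. -/
theorem IsRelativelyL1.ketBra {R : Set H} (h : IsRelativelyL1 u R) (R' : Set H) :
    IsRelativelyL1Alg (adAction u) {T | ∃ ξ ∈ R, ∃ η ∈ R', T = ketBra ξ η} := by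
  rintro _ ⟨ξ, hξ, η, -, rfl⟩ _ ⟨ξ', hξ', η', -, rfl⟩
  refine ((h ξ hξ ξ' hξ').mul_right (‖η‖ * ‖η'‖)).congr fun t => ?_
  have e : ‖(u t : H →L[ℂ] H) η'‖ = ‖η'‖ := (Unitary.linearIsometryEquiv (u t)).norm_map η'
  rw [star_ketBra, adAction_ketBra, ketBra_mul_ketBra, norm_smul, norm_ketBra, e]

theorem adAction_smul (t : G) (c : ℂ) (a : compactOps H) :
    adAction u t (c • a) = c • adAction u t a :=
  (adAction u t).map_smul' c a

/-- The product collapses to the scalar `⟨η, η'⟩` times `|ξ⟩⟨ξ'|`. -/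
theorem isStrictIntegral_ketBra_mul_star {ξ ξ' : H} {V W : EllTwo G →L[ℂ] H} (hV : IsKet u ξ V)
    (hW : IsKet u ξ' W) (η η' : H) :
    IsStrictIntegral (fun t => adAction u t (ketBra ξ η * star (ketBra ξ' η')))
      (⟪η, η'⟫_ℂ • multiplierOfOperator (V ∘L adjoint W)) := by
  have h := (isStrictIntegral_ketBra hV hW).const_smul ⟪η, η'⟫_ℂ
  have e : ∀ t, adAction u t (ketBra ξ η * star (ketBra ξ' η')) =
      ⟪η, η'⟫_ℂ • adAction u t (ketBra ξ ξ') := fun t => by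
    rw [star_ketBra, ketBra_mul_ketBra]
    exact adAction_smul t _ _
  simpa only [e] using h

theorem ketBraSpan_eq (R : Set H) :
    ketBraSpan R = Submodule.span ℂ {T | ∃ ξ ∈ R, ∃ η ∈ Set.univ, T = ketBra ξ η} := by
  simp [ketBraSpan]

theorem isInvariant_multiplierOfOperator {T : H →L[ℂ] H}
    (hT : ∀ t, Commute (u t : H →L[ℂ] H) T) :
    IsInvariant (adAction u) (multiplierOfOperator T) := by
  -- The adjoint of `u_t` is `u_{t⁻¹}`, so commutation with it needs no self-adjointness of `T`.
  have hT' : ∀ t, Commute (star (u t : H →L[ℂ] H)) T := fun t => by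
    have := hT t⁻¹
    rwa [map_inv, ← Unitary.star_eq_inv, Unitary.coe_star] at this
  refine fun t a => ⟨Subtype.ext ?_, Subtype.ext ?_⟩
  · change (u t : H →L[ℂ] H) * (T * a.1) * star (u t : H →L[ℂ] H) =
      T * ((u t : H →L[ℂ] H) * a.1 * star (u t : H →L[ℂ] H))
    rw [← mul_assoc, (hT t).eq, mul_assoc, mul_assoc, mul_assoc]
  · change (u t : H →L[ℂ] H) * (a.1 * T) * star (u t : H →L[ℂ] H) =
      (u t : H →L[ℂ] H) * a.1 * star (u t : H →L[ℂ] H) * T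
    rw [mul_assoc, mul_assoc, mul_assoc, ← (hT' t).eq, mul_assoc]

/-- The span of the operators `|ξ⟩⟨η|` with `ξ, η ∈ R`, as a `*`-algebra. -/
def ketBraAlgebra (R : Set H) : NonUnitalStarSubalgebra ℂ (compactOps H) where
  toSubmodule := Submodule.span ℂ {T | ∃ ξ ∈ R, ∃ η ∈ R, T = ketBra ξ η}
  mul_mem' := by
    intro a b ha hb
    change a * b ∈ Submodule.span ℂ _
    induction ha using Submodule.span_induction with
    | zero => simp
    | add x y _ _ hx hy => rw [add_mul]; exact add_mem hx hy
    | smul c x _ hx => rw [smul_mul_assoc]; exact Submodule.smul_mem _ c hx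
    | mem x hx =>
      obtain ⟨ξ, hξ, η, hη, rfl⟩ := hx
      change b ∈ Submodule.span ℂ _ at hb
      induction hb using Submodule.span_induction with
      | zero => simp
      | add x y _ _ hx hy => rw [mul_add]; exact add_mem hx hy
      | smul c x _ hx => rw [mul_smul_comm]; exact Submodule.smul_mem _ c hx
      | mem x hx =>
        obtain ⟨ξ', hξ', η', hη', rfl⟩ := hx
        rw [ketBra_mul_ketBra]
        exact Submodule.smul_mem _ _ (Submodule.subset_span ⟨ξ, hξ, η', hη', rfl⟩)
  star_mem' := by
    intro a ha
    change star a ∈ Submodule.span ℂ _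
    induction ha using Submodule.span_induction with
    | zero => simp
    | add x y _ _ hx hy => rw [star_add]; exact add_mem hx hy
    | smul c x _ hx => rw [star_smul]; exact Submodule.smul_mem _ _ hx
    | mem x hx =>
      obtain ⟨ξ, hξ, η, hη, rfl⟩ := hx
      exact Submodule.subset_span ⟨η, hη, ξ, hξ, star_ketBra ξ η⟩

theorem coe_ketBraAlgebra (R : Set H) : (ketBraAlgebra R : Set (compactOps H)) =
    Submodule.span ℂ {T : compactOps H | ∃ ξ ∈ R, ∃ η ∈ R, T = ketBra ξ η} := rfl

theorem ketBra_mem_ketBraAlgebra {R : Set H} {ξ η : H} (hξ : ξ ∈ R) (hη : η ∈ R) :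
    ketBra ξ η ∈ ketBraAlgebra R :=
  Submodule.subset_span ⟨ξ, hξ, η, hη, rfl⟩

theorem map_mem_ketBraAlgebra {R : Set H} {L : compactOps H →ₗ[ℂ] compactOps H}
    (h : ∀ ξ ∈ R, ∀ η ∈ R, L (ketBra ξ η) ∈ ketBraAlgebra R) {a : compactOps H}
    (ha : a ∈ ketBraAlgebra R) : L a ∈ ketBraAlgebra R := by
  have : Submodule.span ℂ {T : compactOps H | ∃ ξ ∈ R, ∃ η ∈ R, T = ketBra ξ η} ≤
      (ketBraAlgebra R).toSubmodule.comap L :=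
    Submodule.span_le.2 <| by rintro _ ⟨ξ, hξ, η, hη, rfl⟩; exact h ξ hξ η hη
  exact this ha

theorem adAction_mem_ketBraAlgebra {R : Set H} {t : G}
    (h : ∀ ξ ∈ R, (u t : H →L[ℂ] H) ξ ∈ R) {a : compactOps H} (ha : a ∈ ketBraAlgebra R) :
    adAction u t a ∈ ketBraAlgebra R := by
  refine map_mem_ketBraAlgebra (L :=
    { toFun := adAction u t
      map_add' := (adAction u t).map_add'
      map_smul' := adAction_smul t }) ?_ ha
  intro x hx y hy
  change adAction u t (ketBra x y) ∈ _
  rw [adAction_ketBra]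
  exact ketBra_mem_ketBraAlgebra (h x hx) (h y hy)

theorem compactMulLeft_mem_ketBraAlgebra {R : Set H} {T : H →L[ℂ] H} (h : ∀ ξ ∈ R, T ξ ∈ R)
    {a : compactOps H} (ha : a ∈ ketBraAlgebra R) : compactMulLeft T a ∈ ketBraAlgebra R := by
  refine map_mem_ketBraAlgebra (L := (compactMulLeft T).toLinearMap) ?_ ha
  intro x hx y hy
  rw [coe_coe, compactMulLeft_ketBra]
  exact ketBra_mem_ketBraAlgebra (h x hx) hy

theorem compactMulRight_mem_ketBraAlgebra {R : Set H} {T : H →L[ℂ] H}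
    (h : ∀ ξ ∈ R, star T ξ ∈ R) {a : compactOps H} (ha : a ∈ ketBraAlgebra R) :
    compactMulRight T a ∈ ketBraAlgebra R := by
  refine map_mem_ketBraAlgebra (L := (compactMulRight T).toLinearMap) ?_ ha
  intro x hx y hy
  rw [coe_coe, compactMulRight_ketBra]
  exact ketBra_mem_ketBraAlgebra hx (h y hy)

theorem ketBraAlgebra_le_ketBraSpan (R : Set H) :
    (ketBraAlgebra R : Set (compactOps H)) ⊆ ketBraSpan R :=
  Submodule.span_mono (by rintro _ ⟨ξ, hξ, η, _, rfl⟩; exact ⟨ξ, hξ, η, rfl⟩)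

end Representation

end RieffelProper

end

/-! ### Properties of R_S, and identification of the fixed-point algebra, Fix and F(R_S). -/

noncomputable section

namespace RieffelProper

open ContinuousLinearMap Filter Topology

variable {k : ℕ} {S : Set (UnitAddTorus (Fin k))}

/-- The element of `ℓ²(ℤ^k)` whose Fourier transform is the continuous function `g`. -/
def fourierInv (g : C(UnitAddTorus (Fin k), ℂ)) : EllTwo (IntPow k) :=
  (fourierL2 k).symm (ContinuousMap.toLp 2 (torusHaar k) ℂ g)

theorem fourierL2_fourierInv (g : C(UnitAddTorus (Fin k), ℂ)) :
    fourierL2 k (fourierInv g) =ᵐ[torusHaar k] g := by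
  rw [fourierInv, LinearIsometryEquiv.apply_symm_apply]
  exact ContinuousMap.coeFn_toLp _ g

theorem continuous_fourierInv : Continuous (fourierInv (k := k)) :=
  (fourierL2 k).symm.continuous.comp (ContinuousMap.toLp 2 (torusHaar k) ℂ).continuous

theorem denseRange_fourierInv : DenseRange (fourierInv (k := k)) :=
  (fourierL2 k).symm.surjective.denseRange.comp
    (ContinuousMap.toLp_denseRange ℂ (torusHaar k) ℂ (by norm_num))
    (fourierL2 k).symm.continuous

theorem eq_fourierInv {ξ : EllTwo (IntPow k)} {g : C(UnitAddTorus (Fin k), ℂ)}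
    (h : fourierL2 k ξ =ᵐ[torusHaar k] g) : ξ = fourierInv g :=
  (fourierL2 k).injective (Lp.ext (h.trans (fourierL2_fourierInv g).symm))

theorem fourierMul_fourierInv (f g : C(UnitAddTorus (Fin k), ℂ)) :
    fourierMul k f (fourierInv g) = fourierInv (f * g) := by
  refine eq_fourierInv ?_
  filter_upwards [isFourierMultiplier_fourierMul f (fourierInv g), fourierL2_fourierInv g]
    with z h1 h2
  rw [h1, h2, ContinuousMap.mul_apply]

theorem coe_fourierPreimage :
    (fourierPreimage S : Set (EllTwo (IntPow k))) = fourierInv '' ccSmooth S := by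
  ext ξ
  rw [SetLike.mem_coe, mem_fourierPreimage_iff]
  constructor
  · rintro ⟨g, hg, h⟩; exact ⟨g, hg, (eq_fourierInv h).symm⟩
  · rintro ⟨g, hg, rfl⟩; exact ⟨g, hg, fourierL2_fourierInv g⟩

theorem fourierInv_mem {g : C(UnitAddTorus (Fin k), ℂ)} (hg : g ∈ ccSmooth S) :
    fourierInv g ∈ fourierPreimage S :=
  mem_fourierPreimage_iff.2 ⟨g, hg, fourierL2_fourierInv g⟩

theorem exists_fourierInv_eq {ξ : EllTwo (IntPow k)} (hξ : ξ ∈ fourierPreimage S) :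
    ∃ g ∈ ccSmooth S, fourierInv g = ξ := by
  obtain ⟨g, hg, h⟩ := mem_fourierPreimage_iff.1 hξ
  exact ⟨g, hg, (eq_fourierInv h).symm⟩

theorem isKet_fourierInv_iff {g : C(UnitAddTorus (Fin k), ℂ)}
    {V : EllTwo (IntPow k) →L[ℂ] EllTwo (IntPow k)} :
    IsKet (rho k) (fourierInv g) V ↔ V = fourierMul k g :=
  isKet_rho_iff (fourierL2_fourierInv g) V

theorem fourierMul_mem_fourierPreimage {f : C(UnitAddTorus (Fin k), ℂ)} (hf : IsSmoothTorus f)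
    {ξ : EllTwo (IntPow k)} (hξ : ξ ∈ fourierPreimage S) :
    fourierMul k f ξ ∈ fourierPreimage S := by
  obtain ⟨g, hg, rfl⟩ := exists_fourierInv_eq hξ
  rw [fourierMul_fourierInv]
  exact fourierInv_mem (mul_mem_ccSmooth hf hg)

theorem rho_mem_fourierPreimage (t : IntPow k) {ξ : EllTwo (IntPow k)}
    (hξ : ξ ∈ fourierPreimage S) :
    (rho k t : EllTwo (IntPow k) →L[ℂ] EllTwo (IntPow k)) ξ ∈ fourierPreimage S := by
  rw [rho_eq_fourierMul]
  exact fourierMul_mem_fourierPreimage (isSmoothTorus_mFourier _) hξ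

theorem exists_continuous_eq_zero_iff_notMem (hS : IsOpen S) :
    ∃ d : C(UnitAddTorus (Fin k), ℂ), ∀ z, d z = 0 ↔ z ∉ S := by
  -- The distance to the complement works unless the complement is empty, where `infDist` defaults
  -- to `0`; the constant `1` is used there.
  rcases Sᶜ.eq_empty_or_nonempty with h | h
  · rw [Set.compl_empty_iff] at h
    exact ⟨1, fun z => by simp [h]⟩
  · refine ⟨⟨fun z => (Metric.infDist z Sᶜ : ℂ), by fun_prop⟩, fun z => ?_⟩
    rw [ContinuousMap.coe_mk, Complex.ofReal_eq_zero, ← hS.isClosed_compl.mem_iff_infDist_zero h,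
      Set.mem_compl_iff]

/-- The orthogonal complement of the range is the kernel of the adjoint, multiplication by `conj d`,
which is injective because `d ≠ 0` almost everywhere. -/
theorem denseRange_fourierMul {d : C(UnitAddTorus (Fin k), ℂ)}
    (hd : ∀ᵐ z ∂torusHaar k, d z ≠ 0) : DenseRange (fourierMul k d) := by
  have hker : (adjoint (fourierMul k d)).ker = ⊥ := by
    rw [← star_eq_adjoint, ← map_star, LinearMap.ker_eq_bot']
    intro ξ hξ
    rw [coe_coe] at hξ
    refine (fourierL2 k).injective ?_
    rw [map_zero]
    ext1
    have h := isFourierMultiplier_fourierMul (star d) ξ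
    rw [hξ, map_zero] at h
    filter_upwards [h, Lp.coeFn_zero ℂ 2 (torusHaar k), hd] with z h1 h2 h3
    rw [h2, Pi.zero_apply] at h1 ⊢
    simpa [h3] using h1.symm
  have h := orthogonal_range (fourierMul k d)
  rw [hker, ← Submodule.topologicalClosure_eq_top_iff] at h
  exact Submodule.dense_iff_topologicalClosure_eq_top.2 h

/-- With `d` vanishing exactly off `S`, the products `d g` lie in the uniform closure of `C_c^∞(S)`.
They are dense in L² because the zero set of `d` is null; this is where full measure enters. -/
theorem dense_fourierPreimage (hS : IsOpen S) (h0 : torusHaar k Sᶜ = 0) :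
    Dense (fourierPreimage S : Set (EllTwo (IntPow k))) := by
  obtain ⟨d, hd⟩ := exists_continuous_eq_zero_iff_notMem hS
  have hd' : ∀ᵐ z ∂torusHaar k, d z ≠ 0 := by
    filter_upwards [mem_ae_iff.2 h0] with z hz
    simpa [hd] using hz
  have h1 : DenseRange fun g => fourierMul k d (fourierInv g) :=
    (denseRange_fourierMul hd').comp denseRange_fourierInv (fourierMul k d).continuous
  refine dense_closure.1 (h1.mono ?_)
  rintro _ ⟨g, rfl⟩
  beta_reduce
  rw [fourierMul_fourierInv, coe_fourierPreimage]
  refine image_closure_subset_closure_image continuous_fourierInv ⟨_, ?_, rfl⟩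
  refine mem_closure_ccSmooth hS fun z hz => ?_
  rw [ContinuousMap.mul_apply, (hd z).2 hz, zero_mul]

/-- By Parseval, `⟨ξ, ρ_t η⟩` is the `t`-th Fourier coefficient of the smooth function `conj f · g`.
-/
theorem isRelativelyL1_fourierPreimage :
    IsRelativelyL1 (rho k) (fourierPreimage S : Set (EllTwo (IntPow k))) := by
  intro ξ hξ η hη
  obtain ⟨f, hf, rfl⟩ := exists_fourierInv_eq hξ
  obtain ⟨g, hg, rfl⟩ := exists_fourierInv_eq hη
  refine (hf.1.star.mul hg.1).summable.congr fun t => ?_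
  have e : ⟪fourierInv f, (rho k (Multiplicative.ofAdd t) :
      EllTwo (IntPow k) →L[ℂ] EllTwo (IntPow k)) (fourierInv g)⟫_ℂ =
      ∫ z, UnitAddTorus.mFourier (-t) z * (star (f : UnitAddTorus (Fin k) → ℂ) * g) z
        ∂torusHaar k := by
    rw [← (fourierL2 k).inner_map_map, L2.inner_def]
    refine integral_congr_ae ?_
    filter_upwards [fourierL2_fourierInv f, fourierL2_fourierInv g,
      fourierL2_rho (Multiplicative.ofAdd t) (fourierInv g)] with z h1 h2 h3
    rw [h1, h3, h2, RCLike.inner_apply, toAdd_ofAdd, Pi.mul_apply, Pi.star_apply]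
    change _ * starRingEnd ℂ (f z) = _ * (starRingEnd ℂ (f z) * _)
    ring
  exact congrArg norm e.symm

theorem ccSmooth_add {f g : C(UnitAddTorus (Fin k), ℂ)} (hf : f ∈ ccSmooth S)
    (hg : g ∈ ccSmooth S) : f + g ∈ ccSmooth S :=
  ⟨hf.1.add hg.1, (tsupport_add f g).trans (Set.union_subset hf.2 hg.2)⟩

theorem ccSmooth_smul (c : ℂ) {f : C(UnitAddTorus (Fin k), ℂ)} (hf : f ∈ ccSmooth S) :
    c • f ∈ ccSmooth S :=
  ⟨hf.1.const_smul c, (closure_mono (Function.support_const_smul_subset c f)).trans hf.2⟩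

theorem ccSmooth_zero : (0 : C(UnitAddTorus (Fin k), ℂ)) ∈ ccSmooth S :=
  ⟨contDiff_const, by simp [tsupport]⟩

/-- The representation of `C(𝕋^k)` in `M(K(ℓ²(ℤ^k)))` by Fourier multipliers. -/
def fourierMultiplier (k : ℕ) :
    C(UnitAddTorus (Fin k), ℂ) →⋆ₙₐ[ℂ] 𝓜(ℂ, compactOps (EllTwo (IntPow k))) :=
  multiplierOfOperator.comp (fourierMul k)

theorem fourierMultiplier_injective : Function.Injective (fourierMultiplier k) :=
  multiplierOfOperator_injective.comp fourierMul_injective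

/-- The Fourier multipliers with symbol in `C_c^∞(S)`. -/
def ccSmoothMultipliers (S : Set (UnitAddTorus (Fin k))) :
    Submodule ℂ 𝓜(ℂ, compactOps (EllTwo (IntPow k))) where
  carrier := fourierMultiplier k '' ccSmooth S
  add_mem' := by
    rintro _ _ ⟨f, hf, rfl⟩ ⟨g, hg, rfl⟩
    exact ⟨f + g, ccSmooth_add hf hg, map_add (fourierMultiplier k) f g⟩
  zero_mem' := ⟨0, ccSmooth_zero, map_zero (fourierMultiplier k)⟩
  smul_mem' := by
    rintro c _ ⟨f, hf, rfl⟩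
    exact ⟨c • f, ccSmooth_smul c hf, map_smul (fourierMultiplier k) c f⟩

set_option maxHeartbeats 2000000 in
theorem isStrictIntegral_fourierInv (g h : C(UnitAddTorus (Fin k), ℂ)) (η η' : EllTwo (IntPow k)) :
    IsStrictIntegral
      (fun t => adRho k t (ketBra (fourierInv g) η * star (ketBra (fourierInv h) η')))
      (⟪η, η'⟫_ℂ • fourierMultiplier k (g * star h)) := by
  have h1 := isStrictIntegral_ketBra_mul_star (isKet_fourierInv_iff.2 (rfl : fourierMul k g = _))
    (isKet_fourierInv_iff.2 (rfl : fourierMul k h = _)) η η'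
  rwa [← star_eq_adjoint, ← map_star, ← mul_def, ← map_mul] at h1

set_option maxHeartbeats 2000000 in
/-- The strict-unconditional sums that generate the generalised fixed-point algebra exist and are
Fourier multipliers. -/
theorem exists_isStrictIntegral {a b : compactOps (EllTwo (IntPow k))}
    (ha : a ∈ compactPreimage S) (hb : b ∈ compactPreimage S) :
    ∃ f ∈ ccSmooth S, IsStrictIntegral (fun t => adRho k t (a * star b))
      (fourierMultiplier k f) := by
  obtain ⟨_, ⟨f, hf, rfl⟩, h⟩ := exists_isStrictIntegral_of_mem_span
    (M := ccSmoothMultipliers S) (α := adRho k) (by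
      rintro _ ⟨ξ, hξ, η, rfl⟩ _ ⟨ξ', hξ', η', rfl⟩
      obtain ⟨g, hg, rfl⟩ := exists_fourierInv_eq hξ
      obtain ⟨h, hh, rfl⟩ := exists_fourierInv_eq hξ'
      refine ⟨_, Submodule.smul_mem _ _ ⟨g * star h, ?_, rfl⟩,
        isStrictIntegral_fourierInv g h η η'⟩
      rw [mul_comm]
      exact mul_mem_ccSmooth hh.1.star hg) ha hb
  exact ⟨f, hf, h⟩

theorem isInvariant_fourierMul (f : C(UnitAddTorus (Fin k), ℂ)) :
    IsInvariant (adRho k) (fourierMultiplier k f) :=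
  isInvariant_multiplierOfOperator fun t => by
    rw [rho_eq_fourierMul]
    exact (Commute.all _ f).map (fourierMul k)

set_option maxHeartbeats 2000000 in
-- Both entries are restricted to `R_S`, which makes the span closed under adjoints. The inner
-- products have smooth symbols, and smooth multipliers preserve `R_S`, so they multiply the algebra
-- into itself from both sides.
theorem isRieffelSubalgebra_ketBraAlgebra (hS : IsOpen S) (h0 : torusHaar k Sᶜ = 0) :
    IsRieffelSubalgebra (adRho k)
      (ketBraAlgebra (fourierPreimage S : Set (EllTwo (IntPow k)))) := by
  have hd := dense_fourierPreimage hS h0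
  have hL1 := (isRelativelyL1_fourierPreimage (S := S)).ketBra (fourierPreimage S) |>.span
  rw [← coe_ketBraAlgebra] at hL1
  refine ⟨dense_span_ketBra hd hd,
    fun t ξ hξ => adAction_mem_ketBraAlgebra (fun x hx => rho_mem_fourierPreimage t hx) hξ, hL1,
    fun ξ hξ η hη => ?_⟩
  obtain ⟨f, hf, hf'⟩ := exists_isStrictIntegral (ketBraAlgebra_le_ketBraSpan _ hξ)
    (ketBraAlgebra_le_ketBraSpan _ hη)
  refine ⟨_, isInvariant_fourierMul f, fun ζ hζ => ⟨?_, (hf' ζ).1⟩,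
    fun ζ hζ => compactMulLeft_mem_ketBraAlgebra
      (fun x hx => fourierMul_mem_fourierPreimage hf.1 hx) hζ,
    fun ζ hζ => compactMulRight_mem_ketBraAlgebra (fun x hx => ?_) hζ⟩
  · exact hL1.summable_mul (star_mem (mul_mem hξ (star_mem hη))) hζ
  · have h : star (fourierMul k f) x ∈ fourierPreimage S := by
      rw [← map_star (fourierMul k) f]
      exact fourierMul_mem_fourierPreimage hf.1.star hx
    exact h

theorem exists_mem_fourierPreimage_inner_self_eq_one (hS : IsOpen S) (h0 : torusHaar k Sᶜ = 0) :
    ∃ η ∈ fourierPreimage S, ⟪η, η⟫_ℂ = 1 := by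
  classical
  have hne : (lp.single 2 1 1 : EllTwo (IntPow k)) ≠ 0 := by
    rw [← norm_ne_zero_iff, lp.norm_single (by norm_num)]; simp
  obtain ⟨η, hη, hη'⟩ := (dense_fourierPreimage hS h0).exists_mem_open isOpen_compl_singleton
    ⟨_, hne⟩
  have hη0 : (‖η‖ : ℂ) ≠ 0 := by simpa using hη'
  refine ⟨(‖η‖⁻¹ : ℂ) • η, Submodule.smul_mem _ _ hη, ?_⟩
  rw [inner_smul_left, inner_smul_right, inner_self_eq_norm_sq_to_K]
  simp only [map_inv₀, Complex.conj_ofReal, Complex.coe_algebraMap]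
  field_simp

set_option maxHeartbeats 2000000 in
-- Allowing any `R` between `|R_S⟩⟨R_S|` and `R_{S,K}` handles Rieffel's subalgebra and `R_{S,K}`
-- with one computation.
theorem coe_fixedPointAlgebra (hS : IsOpen S) (h0 : torusHaar k Sᶜ = 0)
    {R : Set (compactOps (EllTwo (IntPow k)))}
    (hR : (ketBraAlgebra (fourierPreimage S : Set (EllTwo (IntPow k))) :
      Set (compactOps (EllTwo (IntPow k)))) ⊆ R) (hR' : R ⊆ compactPreimage S) :
    (fixedPointAlgebra (adRho k) R : Set 𝓜(ℂ, compactOps (EllTwo (IntPow k)))) =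
      Set.range ((fourierMultiplier k).comp (extendZeroHom hS)) := by
  refine coe_closure_adjoin_eq_range hS fourierMultiplier_injective ?_ ?_
  · rintro m ⟨a, ha, b, hb, hm⟩
    obtain ⟨f, hf, hf'⟩ := exists_isStrictIntegral (hR' ha) (hR' hb)
    exact ⟨f, hf, hf'.unique hm⟩
  · intro g hg h hh
    -- A unit vector as common second entry removes the scalar factor, so the integral has symbol
    -- exactly `g · conj h`.
    obtain ⟨η, hη, hη'⟩ := exists_mem_fourierPreimage_inner_self_eq_one hS h0
    refine ⟨_, hR (ketBra_mem_ketBraAlgebra (fourierInv_mem hg) hη), _,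
      hR (ketBra_mem_ketBraAlgebra (fourierInv_mem hh) hη), ?_⟩
    have := isStrictIntegral_fourierInv g h η η
    rwa [hη', one_smul] at this

theorem coe_Fix (hS : IsOpen S) :
    (Fix (rho k) (fourierPreimage S) : Set (EllTwo (IntPow k) →L[ℂ] EllTwo (IntPow k))) =
      Set.range ((fourierMul k).comp (extendZeroHom hS)) := by
  refine coe_closure_adjoin_eq_range hS fourierMul_injective ?_ ?_
  · rintro _ ⟨ξ, hξ, η, hη, V, W, hV, hW, rfl⟩
    obtain ⟨g, hg, rfl⟩ := exists_fourierInv_eq hξ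
    obtain ⟨h, hh, rfl⟩ := exists_fourierInv_eq hη
    rw [isKet_fourierInv_iff] at hV hW
    refine ⟨star h * g, mul_mem_ccSmooth hh.1.star hg, ?_⟩
    rw [hV, hW, mul_comm, map_mul, map_star, star_eq_adjoint, mul_def]
  · intro g hg h hh
    refine ⟨_, fourierInv_mem hg, _, fourierInv_mem hh, _, _, isKet_fourierInv_iff.2 rfl,
      isKet_fourierInv_iff.2 rfl, ?_⟩
    rw [map_mul, map_star, star_eq_adjoint, mul_def]

/-- Translation multiplies the transform by a smooth character, so `R_S` is already translation
invariant. -/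
theorem convSpan_fourierPreimage :
    convSpan (rho k) (fourierPreimage S : Set (EllTwo (IntPow k))) = fourierPreimage S := by
  refine le_antisymm (Submodule.span_le.2 ?_) fun ξ hξ => Submodule.subset_span ⟨1, ξ, hξ, ?_⟩
  · rintro _ ⟨t, ξ, hξ, rfl⟩
    exact rho_mem_fourierPreimage t hξ
  · rw [map_one]; rfl

theorem coe_ketModule (hS : IsOpen S) :
    (ketModule (rho k) (fourierPreimage S) : Set (EllTwo (IntPow k) →L[ℂ] EllTwo (IntPow k))) =
      Set.range ((fourierMul k).comp (extendZeroHom hS)) := by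
  refine coe_closure_span_eq_range hS fourierMul_injective ?_
  rw [convSpan_fourierPreimage]
  ext V
  constructor
  · rintro ⟨ξ, hξ, hV⟩
    obtain ⟨g, hg, rfl⟩ := exists_fourierInv_eq hξ
    exact ⟨g, hg, (isKet_fourierInv_iff.1 hV).symm⟩
  · rintro ⟨g, hg, rfl⟩
    exact ⟨_, fourierInv_mem hg, isKet_fourierInv_iff.2 rfl⟩

end RieffelProper

end

/-! ### Isomorphisms with C₀(S), including the Hilbert bimodule. -/

noncomputable section

namespace RieffelProper

open ContinuousLinearMap Filter Topology

variable {k : ℕ} {S : Set (UnitAddTorus (Fin k))}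

theorem coe_torusFixedPointAlgebra (hS : IsOpen S) (h0 : torusHaar k Sᶜ = 0) :
    (torusFixedPointAlgebra S : Set 𝓜(ℂ, compactOps (EllTwo (IntPow k)))) =
      Set.range ((fourierMultiplier k).comp (extendZeroHom hS)) :=
  coe_fixedPointAlgebra hS h0 (ketBraAlgebra_le_ketBraSpan _) subset_rfl

/-- The generalised fixed-point algebra is `C₀(S)`. -/
def torusFixedPointAlgebraEquiv (hS : IsOpen S) (h0 : torusHaar k Sᶜ = 0) :
    C₀(S, ℂ) ≃⋆ₐ[ℂ] torusFixedPointAlgebra S :=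
  starAlgEquivOfRange _ (comp_extendZeroHom_injective hS fourierMultiplier_injective) _
    (coe_torusFixedPointAlgebra hS h0)

theorem exists_represents_of_mem_torusFixedPointAlgebra (hS : IsOpen S) (h0 : torusHaar k Sᶜ = 0)
    {m : 𝓜(ℂ, compactOps (EllTwo (IntPow k)))} (hm : m ∈ torusFixedPointAlgebra S) :
    ∃ T ∈ Fix (rho k) (fourierPreimage S), Represents m T := by
  rw [← SetLike.mem_coe, coe_torusFixedPointAlgebra hS h0] at hm
  obtain ⟨f, rfl⟩ := hm
  refine ⟨fourierMul k (extendZeroHom hS f), ?_, represents_multiplierOfOperator _⟩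
  rw [← SetLike.mem_coe, coe_Fix hS]
  exact ⟨f, rfl⟩

theorem exists_represents_of_mem_Fix (hS : IsOpen S) (h0 : torusHaar k Sᶜ = 0)
    {T : EllTwo (IntPow k) →L[ℂ] EllTwo (IntPow k)} (hT : T ∈ Fix (rho k) (fourierPreimage S)) :
    ∃ m ∈ torusFixedPointAlgebra S, Represents m T := by
  rw [← SetLike.mem_coe, coe_Fix hS] at hT
  obtain ⟨f, rfl⟩ := hT
  refine ⟨fourierMultiplier k (extendZeroHom hS f), ?_, represents_multiplierOfOperator _⟩
  rw [← SetLike.mem_coe, coe_torusFixedPointAlgebra hS h0]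
  exact ⟨f, rfl⟩

/-- `Fix(ℓ²(ℤ^k), R_S)` is `C₀(S)`. -/
def fixEquiv (hS : IsOpen S) : C₀(S, ℂ) ≃⋆ₐ[ℂ] Fix (rho k) (fourierPreimage S) :=
  starAlgEquivOfRange _ (comp_extendZeroHom_injective hS fourierMul_injective) _ (coe_Fix hS)

/-- `F(R_S)` is `C₀(S)` as a Banach space. -/
def ketModuleEquiv (hS : IsOpen S) : C₀(S, ℂ) ≃ₗᵢ[ℂ] ketModule (rho k) (fourierPreimage S) :=
  linearIsometryEquivOfRange _ (comp_extendZeroHom_injective hS fourierMul_injective) _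
    (coe_ketModule hS)

theorem coe_ketModuleEquiv (hS : IsOpen S) (f : C₀(S, ℂ)) :
    (ketModuleEquiv hS f : EllTwo (IntPow k) →L[ℂ] EllTwo (IntPow k)) =
      fourierMul k (extendZeroHom hS f) := rfl

theorem extendZeroHom_mul_comp_adjoint (hS : IsOpen S) (f g : C₀(S, ℂ)) :
    fourierMul k (extendZeroHom hS f) ∘L adjoint (fourierMul k (extendZeroHom hS g)) =
      fourierMul k (extendZeroHom hS (f * star g)) := by
  rw [map_mul (extendZeroHom hS), map_star (extendZeroHom hS), map_mul (fourierMul k),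
    map_star (fourierMul k), star_eq_adjoint, mul_def]

theorem adjoint_comp_extendZeroHom_mul (hS : IsOpen S) (f g : C₀(S, ℂ)) :
    adjoint (fourierMul k (extendZeroHom hS f)) ∘L fourierMul k (extendZeroHom hS g) =
      fourierMul k (extendZeroHom hS (star f * g)) := by
  rw [map_mul (extendZeroHom hS), map_star (extendZeroHom hS), map_mul (fourierMul k),
    map_star (fourierMul k), star_eq_adjoint, mul_def]

theorem extendZeroHom_comp (hS : IsOpen S) (f g : C₀(S, ℂ)) :
    fourierMul k (extendZeroHom hS f) ∘L fourierMul k (extendZeroHom hS g) =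
      fourierMul k (extendZeroHom hS (f * g)) := by
  rw [map_mul (extendZeroHom hS), map_mul (fourierMul k), mul_def]

theorem extendZeroHom_comp_of_eq_mul (hS : IsOpen S) {g h : C₀(S, ℂ)}
    {f : C(UnitAddTorus (Fin k), ℂ)} (hh : extendZeroHom hS h = extendZeroHom hS g * f) :
    fourierMul k (extendZeroHom hS g) ∘L fourierMul k f = fourierMul k (extendZeroHom hS h) := by
  rw [hh, map_mul (fourierMul k), mul_def]

set_option maxHeartbeats 1000000 in
/-- The Hilbert bimodule `F(R_S)` is the standard bimodule `C₀(S)`. -/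
def standardBimoduleIso (hS : IsOpen S) : StandardBimoduleIso S where
  Φ := (ketModuleEquiv hS).symm
  Ψ := (fixEquiv hS).symm
  left_inner V W := by
    obtain ⟨f, rfl⟩ := (ketModuleEquiv hS).surjective V
    obtain ⟨g, rfl⟩ := (ketModuleEquiv hS).surjective W
    have e : (ketModuleEquiv hS f).1 ∘L adjoint (ketModuleEquiv hS g).1 =
        (fixEquiv hS (f * star g)).1 := extendZeroHom_mul_comp_adjoint hS f g
    refine ⟨e ▸ (fixEquiv hS (f * star g)).2, ?_⟩
    rw [LinearIsometryEquiv.symm_apply_apply, LinearIsometryEquiv.symm_apply_apply]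
    exact (fixEquiv hS).symm_apply_eq.2 (Subtype.ext e)
  right_inner V W := by
    obtain ⟨f, rfl⟩ := (ketModuleEquiv hS).surjective V
    obtain ⟨g, rfl⟩ := (ketModuleEquiv hS).surjective W
    rw [LinearIsometryEquiv.symm_apply_apply, LinearIsometryEquiv.symm_apply_apply,
      coe_ketModuleEquiv, coe_ketModuleEquiv, adjoint_comp_extendZeroHom_mul]
    exact isFourierMultiplier_fourierMul _
  left_smul T V := by
    obtain ⟨f, rfl⟩ : ∃ f, fixEquiv hS f = T := ⟨_, (fixEquiv hS).apply_symm_apply T⟩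
    obtain ⟨g, rfl⟩ := (ketModuleEquiv hS).surjective V
    have e : (fixEquiv hS f).1 ∘L (ketModuleEquiv hS g).1 = (ketModuleEquiv hS (f * g)).1 :=
      extendZeroHom_comp hS f g
    refine ⟨e ▸ (ketModuleEquiv hS (f * g)).2, ?_⟩
    rw [LinearIsometryEquiv.symm_apply_apply, StarAlgEquiv.symm_apply_apply]
    exact (ketModuleEquiv hS).toEquiv.symm_apply_eq.2 (Subtype.ext e)
  right_smul V f T hT := by
    obtain ⟨g, rfl⟩ := (ketModuleEquiv hS).surjective V
    -- `C₀(S)` is an ideal of `C(𝕋^k)`: the product vanishes off `S`.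
    obtain ⟨h, hh⟩ := exists_extendZeroHom_eq hS (F := extendZeroHom hS g * f) fun z hz => by
      rw [ContinuousMap.mul_apply, coe_extendZeroHom, extendZero_apply_of_notMem g hz, zero_mul]
    have e : (ketModuleEquiv hS g).1 ∘L T = (ketModuleEquiv hS h).1 := by
      rw [hT.eq_fourierMul]
      exact extendZeroHom_comp_of_eq_mul hS hh
    refine ⟨e ▸ (ketModuleEquiv hS h).2, fun z => ?_⟩
    have e' : (ketModuleEquiv hS).symm ⟨(ketModuleEquiv hS g).1 ∘L T,
        e ▸ (ketModuleEquiv hS h).2⟩ = h :=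
      (ketModuleEquiv hS).toEquiv.symm_apply_eq.2 (Subtype.ext e)
    rw [e', LinearIsometryEquiv.symm_apply_apply, ← extendZero_apply_coe,
      ← extendZero_apply_coe g, ← coe_extendZeroHom hS h, hh]
    rfl

end RieffelProper

end

noncomputable section

namespace RieffelProper

open Filter Topology

/-! ## Infinitely many fixed-point algebras -/

/-- The ring `A` is a sum of `m` nonzero, mutually annihilating subsets. -/
def HasOrthogonalDecomposition (A : Type*) [NonUnitalRing A] (m : ℕ) : Prop :=
  ∃ I : Fin m → Set A, (∀ i, ∃ a ∈ I i, a ≠ 0) ∧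
    (∀ i j, i ≠ j → ∀ a ∈ I i, ∀ b ∈ I j, a * b = 0) ∧
    ∀ a, ∃ f : Fin m → A, (∀ i, f i ∈ I i) ∧ a = ∑ i, f i

theorem HasOrthogonalDecomposition.of_equiv {A B : Type*} [NonUnitalRing A] [NonUnitalRing B]
    {m : ℕ} (h : HasOrthogonalDecomposition A m) (e : A ≃+* B) : HasOrthogonalDecomposition B m := by
  obtain ⟨I, h1, h2, h3⟩ := h
  refine ⟨fun i => e '' I i, fun i => ?_, ?_, fun b => ?_⟩
  · obtain ⟨a, ha, ha'⟩ := h1 i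
    exact ⟨e a, ⟨a, ha, rfl⟩, by simpa using ha'⟩
  · rintro i j hij _ ⟨a, ha, rfl⟩ _ ⟨b, hb, rfl⟩
    rw [← map_mul, h2 i j hij a ha b hb, map_zero]
  · obtain ⟨f, hf, hf'⟩ := h3 (e.symm b)
    refine ⟨fun i => e (f i), fun i => ⟨_, hf i, rfl⟩, ?_⟩
    rw [← map_sum, ← hf', e.apply_symm_apply]

/-- Nonzero functions in `C₀(X)` at a given point of a locally compact Hausdorff space. -/
theorem exists_zeroAtInfty_ne_zero {X : Type*} [TopologicalSpace X] [LocallyCompactSpace X]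
    [T2Space X] {U : Set X} (hU : IsOpen U) {x : X} (hx : x ∈ U) :
    ∃ f : C₀(X, ℂ), f x ≠ 0 ∧ ∀ y ∉ U, f y = 0 := by
  obtain ⟨f, hf1, hf2, hf3, -⟩ := exists_continuous_one_zero_of_isCompact
    (isCompact_singleton (x := x)) hU.isClosed_compl (by simpa using hx)
  have hf4 : HasCompactSupport fun y => (f y : ℂ) :=
    hf3.comp_left (g := fun r : ℝ => (r : ℂ)) Complex.ofReal_zero
  refine ⟨⟨⟨fun y => (f y : ℂ), by fun_prop⟩, hf4.is_zero_at_infty⟩, ?_, fun y hy => ?_⟩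
  · have : f x = 1 := hf1 rfl
    simp [this]
  · have : f y = 0 := hf2 hy
    simp [this]

theorem zeroAtInfty_sum_apply {X ι : Type*} [TopologicalSpace X] (s : Finset ι)
    (f : ι → C₀(X, ℂ)) (x : X) : (∑ i ∈ s, f i) x = ∑ i ∈ s, f i x :=
  map_sum (⟨⟨fun g => g x, rfl⟩, fun _ _ => rfl⟩ : C₀(X, ℂ) →+ ℂ) f s

/-- Take `U i` to be the union of the sets where members of `I i` are nonzero. Annihilation gives
disjointness; decomposing a function that is nonzero at `x` shows that `x` is covered. -/
theorem HasOrthogonalDecomposition.exists_isOpen {X : Type*} [TopologicalSpace X]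
    [LocallyCompactSpace X] [T2Space X] {m : ℕ}
    (h : HasOrthogonalDecomposition C₀(X, ℂ) m) :
    ∃ U : Fin m → Set X, (∀ i, IsOpen (U i)) ∧ (∀ i, (U i).Nonempty) ∧
      Pairwise (Function.onFun Disjoint U) ∧ ⋃ i, U i = Set.univ := by
  obtain ⟨I, h1, h2, h3⟩ := h
  refine ⟨fun i => ⋃ f ∈ I i, {x | f x ≠ 0}, fun i => ?_, fun i => ?_, fun i j hij => ?_, ?_⟩
  · exact isOpen_biUnion fun f _ => isOpen_ne_fun (map_continuous f) continuous_const
  · obtain ⟨f, hf, hf'⟩ := h1 i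
    obtain ⟨x, hx⟩ := DFunLike.ne_iff.1 hf'
    exact ⟨x, Set.mem_biUnion hf hx⟩
  · refine Set.disjoint_left.2 fun x hx hx' => ?_
    obtain ⟨f, hf, hfx⟩ := Set.mem_iUnion₂.1 hx
    obtain ⟨g, hg, hgx⟩ := Set.mem_iUnion₂.1 hx'
    have := DFunLike.congr_fun (h2 i j hij f hf g hg) x
    rw [ZeroAtInftyContinuousMap.mul_apply, ZeroAtInftyContinuousMap.zero_apply] at this
    exact (mul_ne_zero hfx hgx) this
  · refine Set.eq_univ_of_forall fun x => ?_
    obtain ⟨a, ha, -⟩ := exists_zeroAtInfty_ne_zero isOpen_univ (Set.mem_univ x)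
    obtain ⟨f, hf, rfl⟩ := h3 a
    by_contra hx
    rw [zeroAtInfty_sum_apply] at ha
    refine ha (Finset.sum_eq_zero fun i _ => by_contra fun hi => hx ?_)
    exact Set.mem_iUnion.2 ⟨i, Set.mem_biUnion (hf i) hi⟩

/-- The members of an open partition are clopen, so cutting a function off with an indicator keeps
it continuous. -/
theorem hasOrthogonalDecomposition_of_isOpen {X : Type*} [TopologicalSpace X]
    [LocallyCompactSpace X] [T2Space X] {m : ℕ} {U : Fin m → Set X} (hU : ∀ i, IsOpen (U i))
    (hne : ∀ i, (U i).Nonempty) (hd : Pairwise (Function.onFun Disjoint U))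
    (hc : ⋃ i, U i = Set.univ) : HasOrthogonalDecomposition C₀(X, ℂ) m := by
  classical
  have hmem : ∀ x, ∃ i, x ∈ U i := fun x => Set.mem_iUnion.1 (hc.symm ▸ Set.mem_univ x)
  have hclopen : ∀ i, IsClopen (U i) := fun i => by
    refine ⟨?_, hU i⟩
    have e : (U i)ᶜ = ⋃ j ∈ {j | j ≠ i}, U j := by
      ext x
      simp only [Set.mem_compl_iff, Set.mem_iUnion, Set.mem_ofPred_eq, exists_prop]
      constructor
      · intro hx
        obtain ⟨j, hj⟩ := hmem x
        exact ⟨j, fun h => hx (h ▸ hj), hj⟩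
      · rintro ⟨j, hji, hj⟩ hx
        exact Set.disjoint_left.1 (hd hji) hj hx
    rw [← isOpen_compl_iff, e]
    exact isOpen_biUnion fun j _ => hU j
  refine ⟨fun i => {f | ∀ x ∉ U i, f x = 0}, fun i => ?_, ?_, fun a => ?_⟩
  · obtain ⟨x, hx⟩ := hne i
    obtain ⟨f, hf, hf'⟩ := exists_zeroAtInfty_ne_zero (hU i) hx
    exact ⟨f, hf', fun h => hf (by rw [h]; rfl)⟩
  · intro i j hij f hf g hg
    ext x
    rw [ZeroAtInftyContinuousMap.mul_apply, ZeroAtInftyContinuousMap.zero_apply]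
    by_cases hx : x ∈ U i
    · rw [hg x (Set.disjoint_left.1 (hd hij) hx), mul_zero]
    · rw [hf x hx, zero_mul]
  · refine ⟨fun i =>
      { toFun := (U i).indicator a
        continuous_toFun := continuous_indicator (by simp [(hclopen i).frontier_eq])
          (map_continuous a).continuousOn
        zero_at_infty' := ?_ }, fun i x hx => Set.indicator_of_notMem hx _, ?_⟩
    · refine squeeze_zero_norm (a := fun x => ‖a x‖) (fun x => norm_indicator_le_norm_self _ _) ?_
      simpa using (zero_at_infty a).norm
    · ext x
      obtain ⟨i, hi⟩ := hmem x
      rw [zeroAtInfty_sum_apply, Finset.sum_eq_single i]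
      · exact (Set.indicator_of_mem hi a).symm
      · exact fun j _ hj => Set.indicator_of_notMem (Set.disjoint_left.1 (hd hj.symm) hi) a
      · exact fun h => absurd (Finset.mem_univ i) h

/-- The slab `{j/(n+1) < x₀ < (j+1)/(n+1)}` in the torus. -/
def torusSlab {k : ℕ} (i₀ : Fin k) (n : ℕ) (j : Fin (n + 1)) : Set (UnitAddTorus (Fin k)) :=
  torusProj '' {x | (j : ℝ) < (n + 1) * x i₀ ∧ (n + 1) * x i₀ < j + 1}

variable {k : ℕ} (i₀ : Fin k) (n : ℕ)

theorem isOpen_torusSlab (j : Fin (n + 1)) : IsOpen (torusSlab i₀ n j) := by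
  refine isOpenQuotientMap_torusProj.isOpenMap _ ?_
  exact (isOpen_lt continuous_const ((continuous_const.mul (continuous_apply i₀)))).inter
    (isOpen_lt (continuous_const.mul (continuous_apply i₀)) continuous_const)

theorem isPreconnected_torusSlab (j : Fin (n + 1)) : IsPreconnected (torusSlab i₀ n j) := by
  refine IsPreconnected.image (Convex.isPreconnected ?_) _
    isOpenQuotientMap_torusProj.continuous.continuousOn
  intro x hx y hy a b ha hb hab
  obtain ⟨hx1, hx2⟩ := hx
  obtain ⟨hy1, hy2⟩ := hy
  have h := convex_Ioo (j : ℝ) (j + 1) ⟨hx1, hx2⟩ ⟨hy1, hy2⟩ ha hb hab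
  simp only [Set.mem_Ioo, smul_eq_mul] at h
  simp only [Set.mem_ofPred_eq, Pi.add_apply, Pi.smul_apply, smul_eq_mul]
  have e : ((n : ℝ) + 1) * (a * x i₀ + b * y i₀) =
    a * ((n + 1) * x i₀) + b * ((n + 1) * y i₀) := by ring
  rwa [e]

theorem torusSlab_nonempty (j : Fin (n + 1)) : (torusSlab i₀ n j).Nonempty := by
  refine ⟨_, fun _ => (j + 1 / 2) / (n + 1), ⟨?_, ?_⟩, rfl⟩ <;>
  · have : (n + 1 : ℝ) ≠ 0 := by positivity
    field_simp
    linarith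

theorem pairwise_disjoint_torusSlab :
    Pairwise (Function.onFun Disjoint (torusSlab i₀ n)) := by
  intro j j' hjj
  refine Set.disjoint_left.2 ?_
  rintro _ ⟨x, ⟨hx1, hx2⟩, rfl⟩ ⟨y, ⟨hy1, hy2⟩, hxy⟩
  -- Both coordinates lie in `[0, 1)`, where the projection to the circle is injective, so the slabs
  -- can be compared on the line.
  have hmem : ∀ (l : Fin (n + 1)) (t : ℝ), (l : ℝ) < (n + 1) * t → (n + 1) * t < l + 1 →
      t ∈ Set.Ico (0 : ℝ) (0 + 1) := by
    intro l t h1 h2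
    have hl : (l : ℝ) + 1 ≤ n + 1 := by exact_mod_cast l.2
    have hl0 : (0 : ℝ) ≤ l := by positivity
    have hn : (0 : ℝ) < n + 1 := by positivity
    constructor
    · exact (pos_of_mul_pos_right (hl0.trans_lt h1) hn.le).le
    · rw [zero_add]
      exact lt_of_mul_lt_mul_left (by linarith) hn.le
  have hxy' : y i₀ = x i₀ := (AddCircle.coe_eq_coe_iff_of_mem_Ico (p := (1 : ℝ))
    (hmem j' _ hy1 hy2) (hmem j _ hx1 hx2)).1 (congr_fun hxy i₀)
  rw [hxy'] at hy1 hy2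
  have h1 : (j : ℝ) < j' + 1 := hx1.trans hy2
  have h2 : (j' : ℝ) < j + 1 := hy1.trans hx2
  norm_cast at h1 h2
  exact hjj (Fin.ext (by omega))

/-- The torus without finitely many parallel subtori of codimension one. -/
def slabUnion : Set (UnitAddTorus (Fin k)) := ⋃ j, torusSlab i₀ n j

theorem isOpen_slabUnion : IsOpen (slabUnion i₀ n) :=
  isOpen_iUnion fun j => isOpen_torusSlab i₀ n j

theorem torusHaar_compl_slabUnion : torusHaar k (slabUnion i₀ n)ᶜ = 0 := by
  have hsub : (slabUnion i₀ n)ᶜ ⊆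
      ⋃ j : Fin (n + 1), {z | z i₀ = (((j : ℝ) / (n + 1) : ℝ) : UnitAddCircle)} := by
    intro z hz
    obtain ⟨x, rfl⟩ := isOpenQuotientMap_torusProj.surjective z
    have hn : (0 : ℝ) < n + 1 := by positivity
    have hx : torusProj x = torusProj fun i => Int.fract (x i) := by
      ext i
      have h0 : ((⌊x i⌋ : ℝ) : UnitAddCircle) = 0 :=
        (AddCircle.coe_eq_zero_iff 1).2 ⟨⌊x i⌋, by simp⟩
      simp only [torusProj]
      rw [← Int.self_sub_floor, AddCircle.coe_sub, h0, sub_zero]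
    set t := Int.fract (x i₀) with ht
    have ht0 : 0 ≤ (n + 1) * t := mul_nonneg hn.le (Int.fract_nonneg _)
    -- With `j` the integer part of `(n + 1) t`, either `t = j/(n + 1)` lies on a removed subtorus
    -- or `z` is in the open slab `j`.
    have hlt : ⌊(n + 1) * t⌋₊ < n + 1 := by
      rw [Nat.floor_lt ht0]
      push_cast
      exact mul_lt_of_lt_one_right hn (Int.fract_lt_one _)
    refine Set.mem_iUnion.2 ⟨⟨_, hlt⟩, ?_⟩
    rcases (Nat.floor_le ht0).eq_or_lt with h | h
    · rw [Set.mem_ofPred_eq, hx]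
      change (t : UnitAddCircle) = _
      rw [h, mul_div_cancel_left₀ _ hn.ne']
    · refine absurd ?_ hz
      have hz' : torusProj x ∈ torusSlab i₀ n ⟨_, hlt⟩ := ⟨_, ⟨h, Nat.lt_floor_add_one _⟩, hx.symm⟩
      exact Set.mem_iUnion.2 ⟨_, hz'⟩
  refine measure_mono_null hsub (measure_iUnion_null fun j => ?_)
  -- In a nontrivial connected T₁ space no point is isolated; this makes Haar measure on the circle
  -- atomless, and hence the subtorus null.
  have : Nontrivial UnitAddCircle := ⟨0, ((1 / 2 : ℝ) : UnitAddCircle), fun h =>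
    by simpa using (AddCircle.coe_eq_zero_iff_of_mem_Ico (p := (1 : ℝ)) (a := 1 / 2)
      ⟨by norm_num, by norm_num⟩).1 h.symm⟩
  have := ConnectedSpace.neBot_nhdsWithin_compl_of_nontrivial_of_t1space (0 : UnitAddCircle)
  exact Measure.pi_hyperplane _ i₀ _

theorem dense_of_torusHaar_compl {S : Set (UnitAddTorus (Fin k))} (h : torusHaar k Sᶜ = 0) :
    Dense S :=
  Measure.dense_of_ae (μ := torusHaar k) (mem_ae_iff.2 h)

theorem hasOrthogonalDecomposition_slabUnion :
    HasOrthogonalDecomposition C₀(slabUnion i₀ n, ℂ) (n + 1) := by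
  have : LocallyCompactSpace (slabUnion i₀ n) := (isOpen_slabUnion i₀ n).locallyCompactSpace
  refine hasOrthogonalDecomposition_of_isOpen (U := fun j => Subtype.val ⁻¹' torusSlab i₀ n j)
    (fun j => (isOpen_torusSlab i₀ n j).preimage continuous_subtype_val) (fun j => ?_)
    (fun i j hij => (pairwise_disjoint_torusSlab i₀ n hij).preimage _) ?_
  · obtain ⟨z, hz⟩ := torusSlab_nonempty i₀ n j
    exact ⟨⟨z, Set.mem_iUnion.2 ⟨j, hz⟩⟩, hz⟩
  · refine Set.eq_univ_of_forall fun z => Set.mem_iUnion.2 ?_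
    exact (Set.mem_iUnion (s := torusSlab i₀ n)).1 z.2

/-- Each of the `n + 1` slabs is connected, so it meets only one of the `m` open pieces. Choosing a
slab that meets each piece is thus injective. -/
theorem le_of_hasOrthogonalDecomposition_slabUnion {m : ℕ}
    (h : HasOrthogonalDecomposition C₀(slabUnion i₀ n, ℂ) m) : m ≤ n + 1 := by
  have : LocallyCompactSpace (slabUnion i₀ n) := (isOpen_slabUnion i₀ n).locallyCompactSpace
  obtain ⟨U, hU, hne, hd, hc⟩ := h.exists_isOpen
  have hslab : ∀ j, IsPreconnected (Subtype.val ⁻¹' torusSlab i₀ n j : Set (slabUnion i₀ n)) := by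
    intro j
    rw [← Topology.IsInducing.subtypeVal.isPreconnected_image, Subtype.image_preimage_coe,
      Set.inter_eq_right.2 (show _ ⊆ slabUnion i₀ n from Set.subset_iUnion (torusSlab i₀ n) j)]
    exact isPreconnected_torusSlab i₀ n j
  choose x hx using hne
  choose j hj using fun i => Set.mem_iUnion.1 (x i).2
  have hinj : Function.Injective j := by
    intro a b hab
    by_contra hne
    -- Were one slab to meet both `U a` and `U b`, it would be split by `U a` and the union of the
    -- remaining pieces.
    have hcover : (Set.univ : Set (slabUnion i₀ n)) ⊆ U a ∪ ⋃ i ∈ {i | i ≠ a}, U i := by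
      intro z _
      obtain ⟨i, hi⟩ := Set.mem_iUnion.1 (hc.symm ▸ Set.mem_univ z)
      by_cases hia : i = a
      · exact Or.inl (hia ▸ hi)
      · exact Or.inr (Set.mem_biUnion hia hi)
    obtain ⟨z, -, hz, hz'⟩ := hslab (j a) _ _ (hU a) (isOpen_biUnion fun i _ => hU i)
      ((Set.subset_univ _).trans hcover) ⟨x a, hj a, hx a⟩
      ⟨x b, hab ▸ hj b, Set.mem_biUnion (Ne.symm hne) (hx b)⟩
    obtain ⟨i, hi, hz'⟩ := Set.mem_iUnion₂.1 hz'
    exact Set.disjoint_left.1 (hd hi) hz' hz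
  simpa using Fintype.card_le_of_injective j hinj

theorem eq_of_ringEquiv_slabUnion {m : ℕ}
    (e : C₀(slabUnion i₀ m, ℂ) ≃+* C₀(slabUnion i₀ n, ℂ)) : m = n := by
  have h1 := le_of_hasOrthogonalDecomposition_slabUnion i₀ n
    ((hasOrthogonalDecomposition_slabUnion i₀ m).of_equiv e)
  have h2 := le_of_hasOrthogonalDecomposition_slabUnion i₀ m
    ((hasOrthogonalDecomposition_slabUnion i₀ n).of_equiv e.symm)
  omega

/-- The isomorphism of function algebras induced by a homeomorphism. -/
def zeroAtInftyCongr {X Y : Type*} [TopologicalSpace X] [TopologicalSpace Y] (e : X ≃ₜ Y) :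
    C₀(X, ℂ) ≃+* C₀(Y, ℂ) where
  toFun f := f.comp ⟨e.symm, e.symm.isClosedEmbedding.tendsto_cocompact⟩
  invFun f := f.comp ⟨e, e.isClosedEmbedding.tendsto_cocompact⟩
  left_inv f := by ext x; exact congrArg f (e.symm_apply_apply x)
  right_inv f := by ext x; exact congrArg f (e.apply_symm_apply x)
  map_mul' _ _ := rfl
  map_add' _ _ := rfl

end RieffelProper

end

/-! ### Assembly of the statements about the fixed-point algebras. -/

namespace RieffelProper

variable {k : ℕ} {S : Set (UnitAddTorus (Fin k))}

set_option maxHeartbeats 1000000 in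
theorem isRieffelProperWrt_compactPreimage (hS : IsOpen S) (h0 : torusHaar k Sᶜ = 0) :
    IsRieffelProperWrt (adRho k) (compactPreimage S) := by
  rw [compactPreimage, ketBraSpan_eq]
  exact ⟨dense_span_ketBra (dense_fourierPreimage hS h0) dense_univ,
    (isRelativelyL1_fourierPreimage.ketBra Set.univ).span⟩

theorem fixedPointAlgebra_ketBraAlgebra (hS : IsOpen S) (h0 : torusHaar k Sᶜ = 0) :
    fixedPointAlgebra (adRho k) (ketBraAlgebra (fourierPreimage S : Set (EllTwo (IntPow k))) :
      Set (compactOps (EllTwo (IntPow k)))) = torusFixedPointAlgebra S :=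
  SetLike.coe_injective ((coe_fixedPointAlgebra hS h0 subset_rfl
    (ketBraAlgebra_le_ketBraSpan _)).trans (coe_torusFixedPointAlgebra hS h0).symm)

set_option maxHeartbeats 4000000 in
/-- The generalised fixed-point algebra is `C₀(S)`. -/
noncomputable def fixedPointAlgebraEquivZeroAtInfty (hS : IsOpen S) (h0 : torusHaar k Sᶜ = 0) :
    torusFixedPointAlgebra S ≃⋆ₐ[ℂ] C₀(S, ℂ) :=
  (torusFixedPointAlgebraEquiv hS h0).symm

set_option synthInstance.maxHeartbeats 400000 in
set_option maxHeartbeats 4000000 in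
theorem eq_of_torusFixedPointAlgebra_slabUnion {i₀ : Fin k} {m n : ℕ}
    (e : torusFixedPointAlgebra (slabUnion i₀ m) ≃⋆ₐ[ℂ]
      torusFixedPointAlgebra (slabUnion i₀ n)) : m = n := by
  let f := fixedPointAlgebraEquivZeroAtInfty (isOpen_slabUnion i₀ m) (torusHaar_compl_slabUnion i₀ m)
  let g := fixedPointAlgebraEquivZeroAtInfty (isOpen_slabUnion i₀ n) (torusHaar_compl_slabUnion i₀ n)
  exact eq_of_ringEquiv_slabUnion i₀ _ ((f.symm.trans (e.trans g) :
    C₀(slabUnion i₀ m, ℂ) ≃⋆ₐ[ℂ] C₀(slabUnion i₀ n, ℂ)) : _ ≃+* _)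

end RieffelProper

set_option maxHeartbeats 4000000 in
open RieffelProper in
theorem mainTheorem8 (k : ℕ) :
    (∀ S : Set (UnitAddTorus (Fin k)), IsOpen S → Dense S → torusHaar k Sᶜ = 0 →
      -- the Fourier preimage `R_S` of `C_c^∞(S)` is a dense relatively `L¹` subspace of `ℓ²(ℤ^k)`
      -- consisting of square-integrable vectors
      Dense (fourierPreimage S : Set (EllTwo (IntPow k))) ∧
      IsRelativelyL1 (rho k) (fourierPreimage S) ∧
      (∀ ξ ∈ fourierPreimage S, ∃ V, IsKet (rho k) ξ V) ∧
      -- `Ad ρ` is Rieffel proper with respect to `R_{S,K} = |R_S⟩⟨ℓ²(ℤ^k)|`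
      IsRieffelProperWrt (adRho k) (compactPreimage S) ∧
      -- the strict-unconditional integrals that generate the fixed-point algebra exist in `M(K)^G`
      (∀ a ∈ compactPreimage S, ∀ b ∈ compactPreimage S,
        ∃ m, IsInvariant (adRho k) m ∧ IsStrictIntegral (fun t => adRho k t (a * star b)) m) ∧
      -- `Ad ρ` is Rieffel proper in the original sense, with the same fixed-point algebra
      (∃ A₀ : NonUnitalStarSubalgebra ℂ (compactOps (EllTwo (IntPow k))),
        IsRieffelSubalgebra (adRho k) A₀ ∧
        fixedPointAlgebra (adRho k) (A₀ : Set (compactOps (EllTwo (IntPow k)))) =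
          torusFixedPointAlgebra S) ∧
      -- under `M(K(H)) = L(H)` the fixed-point algebra is `Fix(ℓ²(ℤ^k), R_S)`
      (∀ m ∈ torusFixedPointAlgebra S, ∃ T ∈ Fix (rho k) (fourierPreimage S), Represents m T) ∧
      (∀ T ∈ Fix (rho k) (fourierPreimage S), ∃ m ∈ torusFixedPointAlgebra S, Represents m T) ∧
      -- the bimodule `F(R_S)` is the standard bimodule `C₀(S)`
      Nonempty (StandardBimoduleIso S) ∧
      -- the fixed-point algebra is `C₀(S)`
      Nonempty (torusFixedPointAlgebra S ≃⋆ₐ[ℂ] C₀(S, ℂ))) ∧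
    -- infinitely many pairwise non-isomorphic fixed-point algebras for the action `Ad ρ`
    (0 < k → ∃ S : ℕ → Set (UnitAddTorus (Fin k)),
      (∀ n, IsOpen (S n) ∧ Dense (S n) ∧ torusHaar k (S n)ᶜ = 0) ∧
      ∀ i j, i ≠ j → IsEmpty (S i ≃ₜ S j) ∧
        IsEmpty (torusFixedPointAlgebra (S i) ≃⋆ₐ[ℂ] torusFixedPointAlgebra (S j))) := by
  refine ⟨fun S hS _ h0 => ?_, fun hk => ?_⟩
  · refine ⟨dense_fourierPreimage hS h0, isRelativelyL1_fourierPreimage, fun ξ hξ => ?_,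
      isRieffelProperWrt_compactPreimage hS h0, fun a ha b hb => ?_,
      ⟨ketBraAlgebra (fourierPreimage S), isRieffelSubalgebra_ketBraAlgebra hS h0,
        fixedPointAlgebra_ketBraAlgebra hS h0⟩,
      fun m hm => exists_represents_of_mem_torusFixedPointAlgebra hS h0 hm,
      fun T hT => exists_represents_of_mem_Fix hS h0 hT,
      ⟨standardBimoduleIso hS⟩, ⟨fixedPointAlgebraEquivZeroAtInfty hS h0⟩⟩
    · obtain ⟨g, -, rfl⟩ := exists_fourierInv_eq hξ
      exact ⟨_, isKet_fourierInv_iff.2 rfl⟩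
    · obtain ⟨f, -, hf⟩ := exists_isStrictIntegral ha hb
      exact ⟨_, isInvariant_fourierMul f, hf⟩
  · have h0 := torusHaar_compl_slabUnion (⟨0, hk⟩ : Fin k)
    exact ⟨slabUnion ⟨0, hk⟩,
      fun n => ⟨isOpen_slabUnion _ n, dense_of_torusHaar_compl (h0 n), h0 n⟩,
      -- Both a homeomorphism and an isomorphism of fixed-point algebras induce a ring isomorphism
      -- of the `C₀` algebras, which forces the slab counts to agree.
      fun i j hij => ⟨⟨fun e => hij (eq_of_ringEquiv_slabUnion _ _ (zeroAtInftyCongr e))⟩,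
        ⟨fun e => hij (eq_of_torusFixedPointAlgebra_slabUnion e)⟩⟩⟩
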